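/- Let $p\ge 1$, let $\widehat\Sigma\in\mathbb R^{p\times p}$ be symmetric with $\widehat\Sigma\succ 0$, and let $\rho>0$ and $\sigma\in(0,\frac12)$. Let $\mathcal E\subseteq\{1,\dots,p\}^2$ be symmetric ($(i,j)\in\mathcal E\Rightarrow(j,i)\in\mathcal E$) with $(i,i)\notin\mathcal E$ for all $i$, and let $\mathcal X=\{X\in\mathbb S^p: X\succ 0,\ X_{ij}=0\ \forall (i,j)\in\mathcal E\}$, where $\mathbb S^p$ is the space of symmetric $p\times p$ matrices. Consider the problem of minimizing $$f(X,\gamma)=-\log\det X+\gamma\big(\rho^2-\mathrm{Tr}[\widehat\Sigma]\big)+\gamma^2\,\mathrm{Tr}\big[(\gamma I-X)^{-1}\widehat\Sigma\big]$$ over all feasible $(X,\gamma)$, that is, all $(X,\gamma)\in\mathcal X\times\mathbb R$ with $\gamma I\succ X\succ 0$. For feasible $(X,\gamma)$ put $G=I-X/\gamma$, $$g=\begin{bmatrix}\mathrm{vec}(G^{-1}\widehat\Sigma G^{-1}-X^{-1})\\ \rho^2+\mathrm{Tr}[G^{-1}\widehat\Sigma(I-\frac1\gamma G^{-1}X)-\widehat\Sigma]\end{bmatrix},\qquad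 H=\begin{bmatrix}X^{-1}\otimes X^{-1}+\frac2\gamma\, G^{-1}\widehat\Sigma G^{-1}\otimes G^{-1} & b\\ b^\top & \frac{2}{\gamma^3}\mathrm{Tr}[G^{-1}XG^{-1}\widehat\Sigma G^{-1}X]\end{bmatrix},$$ where $b=-\frac{1}{\gamma^2}\mathrm{vec}(G^{-1}[XG^{-1}\widehat\Sigma+\widehat\Sigma G^{-1}X]G^{-1})$, and let $P$ be the orthogonal projection of $\mathbb R^{p^2+1}$ onto $\{(\mathrm{vec}(D)^\top,d)^\top: D\in\mathbb S^p,\ D_{ij}=0\ \forall(i,j)\in\mathcal E,\ d\in\mathbb R\}$. The sequential quadratic approximation algorithm with Armijo line search, run without a stopping criterion, generates from a feasible start $(X_0,\gamma_0)$ a sequence $(X_t,\gamma_t)_{t\ge 0}$ as follows. Given $(X_t,\gamma_t)$, form $g,H$ at $(X,\gamma)=(X_t,\gamma_t)$, let $(\Delta_X,\Delta_\gamma)\in\mathbb S^p\times\mathbb R$ solve $$P\big(H(\mathrm{vec}(\Delta_X)^\top,\Delta_\gamma)^\top+g\big)=0,\qquad(\Delta_X)_{ij}=0\ \ \forall(i,j)\in\mathcal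 E,$$ let $\alpha_t$ be the largest number in $\{2^{-m}:m=0,1,2,\dots\}$ for which $\alpha=\alpha_t$ satisfies both $$(\gamma_t+\alpha\Delta_\gamma)I\succ X_t+\alpha\Delta_X\succ 0\quad\text{and}\quad f(X_t+\alpha\Delta_X,\gamma_t+\alpha\Delta_\gamma)\le f(X_t,\gamma_t)+\sigma\alpha\, g^\top(\mathrm{vec}(\Delta_X)^\top,\Delta_\gamma)^\top,$$ and set $(X_{t+1},\gamma_{t+1})=(X_t+\alpha_t\Delta_X,\gamma_t+\alpha_t\Delta_\gamma)$. Then the problem has a unique minimizer $(X^\star,\gamma^\star)$, and from every feasible start $(X_0,\gamma_0)$ the algorithm generates a well-defined (unique, infinite) sequence, which converges to $(X^\star,\gamma^\star)$. Moreover, the convergence is locally quadratic: there exist $\varepsilon>0$ and $C>0$, independent of the start, such that for every sequence so generated and every $t\ge0$, with $\|(X,\gamma)\|=\sqrt{\mathrm{Tr}[X^\top X]+\gamma^2}$, $$\|(X_t,\gamma_t)-(X^\star,\gamma^\star)\|<\varepsilon\ \Longrightarrow\ \|(X_{t+1},\gamma_{t+1})-(X^\star,\gamma^\star)\|\le C\,\|(X_t,\gamma_t)-(X^\star,\gamma^\star)\|^2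 .$$ -/

import Mathlib

open scoped Matrix Kronecker Topology
open Filter

noncomputable section

namespace WassersteinShrinkage

variable {p : ℕ}

/-- Index set of the coordinates of `(vec(X)ᵀ, γ)ᵀ ∈ ℝ^(p²+1)`. As for `Matrix.vec` (which stacks
columns), the coordinate `Sum.inl (j, i)` carries the entry `X i j`; the coordinate
`Sum.inr ()` carries `γ`. -/
abbrev Idx (p : ℕ) : Type := (Fin p × Fin p) ⊕ Unit

/-- The pairs `(X, γ)` of a `p × p` matrix and a real number. -/
abbrev Pair (p : ℕ) : Type := Matrix (Fin p) (Fin p) ℝ × ℝ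

/-- The vector `(vec(X)ᵀ, γ)ᵀ`. -/
def pairVec (z : Pair p) : Idx p → ℝ :=
  Sum.elim (Matrix.vec z.1) (fun _ => z.2)

/-- The Euclidean norm of `(vec(X)ᵀ, γ)ᵀ`, that is `√(‖X‖² + γ²)` with the Frobenius norm
`‖X‖ = √(Tr(Xᵀ X))`. -/
def pairNorm (z : Pair p) : ℝ :=
  Real.sqrt ((z.1ᵀ * z.1).trace + z.2 ^ 2)

/-- The set `𝒳` of positive definite matrices that vanish on the prescribed set `E` of index
pairs. -/
def precisionSet (E : Set (Fin p × Fin p)) : Set (Matrix (Fin p) (Fin p) ℝ) :=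
  {X | X.PosDef ∧ ∀ i j, (i, j) ∈ E → X i j = 0}

/-- The feasible set `{(X, γ) : γ I ≻ X ≻ 0, X ∈ 𝒳}`. -/
def feasibleSet (E : Set (Fin p × Fin p)) : Set (Pair p) :=
  {z | (z.2 • (1 : Matrix (Fin p) (Fin p) ℝ) - z.1).PosDef ∧ z.1.PosDef ∧ z.1 ∈ precisionSet E}

/-- The objective
`f(X, γ) = - log det X + γ (ρ² - Tr Σ̂) + γ² ⟨(γ I - X)⁻¹, Σ̂⟩` with `⟨A, B⟩ = Tr(Aᵀ B)`;
here `S` is the sample covariance matrix `Σ̂`. -/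
def objective (S : Matrix (Fin p) (Fin p) ℝ) (ρ : ℝ) (z : Pair p) : ℝ :=
  - Real.log z.1.det + z.2 * (ρ ^ 2 - S.trace)
    + z.2 ^ 2 * (((z.2 • (1 : Matrix (Fin p) (Fin p) ℝ) - z.1)⁻¹)ᵀ * S).trace

/-- The matrix `G = I - X / γ`. -/
def matG (z : Pair p) : Matrix (Fin p) (Fin p) ℝ := 1 - z.2⁻¹ • z.1

/-- The vector `g` of first-order coefficients of the objective at `(X, γ)`, with blocks
`vec(G⁻¹ Σ̂ G⁻¹ - X⁻¹)` and `ρ² + Tr[G⁻¹ Σ̂ (I - γ⁻¹ G⁻¹ X) - Σ̂]`. -/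
def gradVec (S : Matrix (Fin p) (Fin p) ℝ) (ρ : ℝ) (z : Pair p) : Idx p → ℝ :=
  Sum.elim
    (Matrix.vec ((matG z)⁻¹ * S * (matG z)⁻¹ - z.1⁻¹))
    (fun _ => ρ ^ 2 + ((matG z)⁻¹ * S * (1 - z.2⁻¹ • ((matG z)⁻¹ * z.1)) - S).trace)

/-- The off-diagonal block
`- γ⁻² vec(G⁻¹ [X G⁻¹ Σ̂ + Σ̂ G⁻¹ X] G⁻¹)` of the Hessian. -/
def hessMixed (S : Matrix (Fin p) (Fin p) ℝ) (z : Pair p) : Fin p × Fin p → ℝ :=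
  -(1 / z.2 ^ 2) • Matrix.vec
    ((matG z)⁻¹ * (z.1 * (matG z)⁻¹ * S + S * (matG z)⁻¹ * z.1) * (matG z)⁻¹)

/-- The Hessian matrix `H` of the second-order expansion of the objective at `(X, γ)`. -/
def hessMat (S : Matrix (Fin p) (Fin p) ℝ) (z : Pair p) : Matrix (Idx p) (Idx p) ℝ :=
  Matrix.fromBlocks
    (z.1⁻¹ ⊗ₖ z.1⁻¹ + (2 / z.2) • (((matG z)⁻¹ * S * (matG z)⁻¹) ⊗ₖ (matG z)⁻¹))
    (Matrix.replicateCol Unit (hessMixed S z))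
    (Matrix.replicateRow Unit (hessMixed S z))
    (Matrix.of fun _ _ =>
      2 / z.2 ^ 3 * ((matG z)⁻¹ * z.1 * (matG z)⁻¹ * S * (matG z)⁻¹ * z.1).trace)

open Classical in
/-- The orthogonal projection `P` of `ℝ^(p²+1)` onto the vectors `(vec(D)ᵀ, d)ᵀ` with `D` symmetric
and `D i j = 0` for all `(i, j) ∈ E` (for symmetric `E`). -/
def proj (E : Set (Fin p × Fin p)) (v : Idx p → ℝ) : Idx p → ℝ
  | Sum.inl (j, i) =>
      if (i, j) ∈ E then 0 else 1 / 2 * v (Sum.inl (j, i)) + 1 / 2 * v (Sum.inl (i, j))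
  | Sum.inr u => v (Sum.inr u)

/-- `d = (Δ_X, Δ_γ)`, with `Δ_X` symmetric, is a solution of the linear system
`P (H (vec(Δ_X)ᵀ, Δ_γ)ᵀ + g) = 0`, `(Δ_X) i j = 0` for all `(i, j) ∈ E`,
formed at the point `z = (X, γ)`. -/
def IsDirection (S : Matrix (Fin p) (Fin p) ℝ) (ρ : ℝ) (E : Set (Fin p × Fin p))
    (z d : Pair p) : Prop :=
  d.1.IsSymm ∧ proj E (hessMat S z *ᵥ pairVec d + gradVec S ρ z) = 0 ∧
    ∀ i j, (i, j) ∈ E → d.1 i j = 0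

/-- The step sizes `2⁻ᵐ`, `m = 0, 1, 2, …`, that preserve feasibility and yield a sufficient
decrease `f(z + α d) ≤ f(z) + σ α δ`, where `δ = gᵀ (vec(Δ_X)ᵀ, Δ_γ)ᵀ`. -/
def admissibleSteps (S : Matrix (Fin p) (Fin p) ℝ) (ρ σ : ℝ) (z d : Pair p) : Set ℝ :=
  {α | (∃ m : ℕ, α = 1 / 2 ^ m) ∧
    (((z + α • d).2 • (1 : Matrix (Fin p) (Fin p) ℝ) - (z + α • d).1).PosDef ∧
      (z + α • d).1.PosDef) ∧
    objective S ρ (z + α • d) ≤ objective S ρ z + σ * α * (gradVec S ρ z ⬝ᵥ pairVec d)}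

/-- The sequence `z` is a run of the sequential quadratic approximation algorithm with Armijo line
search (without stopping criterion) from `z₀`: every iteration moves along the direction solving
the linear system, with the largest admissible step size. -/
def IsRun (S : Matrix (Fin p) (Fin p) ℝ) (ρ σ : ℝ) (E : Set (Fin p × Fin p))
    (z₀ : Pair p) (z : ℕ → Pair p) : Prop :=
  z 0 = z₀ ∧ ∀ t, ∃ (d : Pair p) (α : ℝ), IsDirection S ρ E (z t) d ∧
    IsGreatest (admissibleSteps S ρ σ (z t) d) α ∧ z (t + 1) = z t + α • d

/-- `z` is a minimizer of the objective over the feasible set. -/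
def IsMinimizer (S : Matrix (Fin p) (Fin p) ℝ) (ρ : ℝ) (E : Set (Fin p × Fin p))
    (z : Pair p) : Prop :=
  z ∈ feasibleSet E ∧ ∀ w ∈ feasibleSet E, objective S ρ z ≤ objective S ρ w

end WassersteinShrinkage

end

/-! On the linear space `directions E` of symmetric pairs vanishing on `E`, the algorithm is
Newton's method with Armijo backtracking. A vector is annihilated by `P` exactly when it is
orthogonal to this space, and on it `g` and `H` represent the first and second derivatives of `f`;
so the projected system is the Newton equation for the restriction of `f` (`isDirection_iff`,
`iteration_iff`).

The restriction is a convex barrier (`isConvexBarrier_objective`): smooth on an open convex set,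
with positive definite second derivative and compact sublevel sets. Write `R = (γI - X)⁻¹`.
Positivity comes from completing a square in the second derivative (`hessForm_self`,
`hessForm_pos`). Compactness comes from the identity `γ²R = γI + X + XRX`, which turns `f` into
`-log det X` plus nonnegative terms including `γρ²`; a bound on `f` then bounds `γ` above and keeps
`det X` and `det (γI - X)` away from zero (`exists_sublevel_bounds`).

For any convex barrier, a minimizer exists by compactness and is the only critical point by Taylor's
formula. Every step decreases `F`, by a locally uniform amount near noncritical points, so
compactness forces convergence (`tendsto_of_step`). Near the minimizer the full step passes the
Armijo test because `σ < 1/2`, and the Lipschitz second derivative makes it quadratically accurate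
(`exists_quadratic`). -/

/-! ### Damped Newton method for an abstract convex barrier. -/

namespace DampedNewton

/-- The numbers `2⁻ᵐ` that keep the next iterate in `U` and satisfy the Armijo condition. -/
def armijoSteps {V : Type*} [NormedAddCommGroup V] [NormedSpace ℝ V]
    (F : V → ℝ) (U : Set V) (σ : ℝ) (z d : V) : Set ℝ :=
  {α | (∃ m : ℕ, α = 1 / 2 ^ m) ∧ z + α • d ∈ U ∧
    F (z + α • d) ≤ F z + σ * α * fderiv ℝ F z d}

/-- `z'` is the damped Newton iterate following `z`. -/
def Step {V : Type*} [NormedAddCommGroup V] [NormedSpace ℝ V]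
    (F : V → ℝ) (U : Set V) (σ : ℝ) (z z' : V) : Prop :=
  ∃ (d : V) (α : ℝ), fderiv ℝ (fderiv ℝ F) z d = -fderiv ℝ F z ∧
    IsGreatest (armijoSteps F U σ z d) α ∧ z' = z + α • d

/-- `F` is a three times continuously differentiable function on the open convex set `U`, with
positive definite second derivative and compact sublevel sets. -/
structure IsConvexBarrier {V : Type*} [NormedAddCommGroup V] [NormedSpace ℝ V]
    (F : V → ℝ) (U : Set V) : Prop where
  isOpen : IsOpen U
  convex : Convex ℝ U
  contDiffAt : ∀ z ∈ U, ContDiffAt ℝ 3 F z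
  pos : ∀ z ∈ U, ∀ u : V, u ≠ 0 → 0 < fderiv ℝ (fderiv ℝ F) z u u
  compact : ∀ c : ℝ, IsCompact {z | z ∈ U ∧ F z ≤ c}

/-- Taylor's formula of order two on `[0, 1]` with Lagrange remainder. -/
lemma exists_taylor_two {φ φ' φ'' : ℝ → ℝ}
    (h1 : ∀ t ∈ Set.Icc (0 : ℝ) 1, HasDerivAt φ (φ' t) t)
    (h2 : ∀ t ∈ Set.Icc (0 : ℝ) 1, HasDerivAt φ' (φ'' t) t) :
    ∃ t ∈ Set.Ioo (0 : ℝ) 1, φ 1 = φ 0 + φ' 0 + φ'' t / 2 := by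
  -- This `M` makes the auxiliary function below vanish at both 0 and 1, so Rolle's theorem applies.
  set M : ℝ := 2 * (φ 1 - φ 0 - φ' 0) with hM
  have hd : ∀ t ∈ Set.Icc (0 : ℝ) 1,
      HasDerivAt (fun t => φ 1 - φ t - φ' t * (1 - t) - M * (1 - t) ^ 2 / 2)
        ((M - φ'' t) * (1 - t)) t := by
    intro t ht
    have e : HasDerivAt (fun t : ℝ => 1 - t) (-1) t := by
      simpa using (hasDerivAt_id t).const_sub 1
    have := (((h1 t ht).const_sub (φ 1)).sub ((h2 t ht).mul e)).sub
      (((e.pow 2).const_mul M).div_const 2)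
    refine this.congr_deriv ?_
    simp; ring
  obtain ⟨t, ht, h0⟩ := exists_hasDerivAt_eq_zero (a := (0 : ℝ)) (b := 1) zero_lt_one
    (fun t ht => (hd t ht).continuousAt.continuousWithinAt)
    (by simp [hM]) (fun t ht => hd t ⟨ht.1.le, ht.2.le⟩)
  refine ⟨t, ht, ?_⟩
  have : M - φ'' t = 0 := by
    rcases mul_eq_zero.1 h0 with h | h
    · exact h
    · linarith [ht.2]
  linarith

namespace IsConvexBarrier

variable {V : Type*} [NormedAddCommGroup V] [NormedSpace ℝ V] {F : V → ℝ} {U : Set V}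

lemma hasFDerivAt (h : IsConvexBarrier F U) {z : V} (hz : z ∈ U) :
    HasFDerivAt F (fderiv ℝ F z) z :=
  ((h.contDiffAt z hz).differentiableAt (by norm_num)).hasFDerivAt

lemma contDiffAt_fderiv (h : IsConvexBarrier F U) {z : V} (hz : z ∈ U) :
    ContDiffAt ℝ 2 (fderiv ℝ F) z :=
  (h.contDiffAt z hz).fderiv_right (by norm_num)

lemma hasFDerivAt_fderiv (h : IsConvexBarrier F U) {z : V} (hz : z ∈ U) :
    HasFDerivAt (fderiv ℝ F) (fderiv ℝ (fderiv ℝ F) z) z :=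
  ((h.contDiffAt_fderiv hz).differentiableAt (by norm_num)).hasFDerivAt

lemma contDiffAt_fderiv_fderiv (h : IsConvexBarrier F U) {z : V} (hz : z ∈ U) :
    ContDiffAt ℝ 1 (fderiv ℝ (fderiv ℝ F)) z :=
  (h.contDiffAt_fderiv hz).fderiv_right (by norm_num)

lemma add_smul_mem (h : IsConvexBarrier F U) {z w : V} (hz : z ∈ U) (hw : z + w ∈ U) {t : ℝ}
    (ht : t ∈ Set.Icc (0 : ℝ) 1) : z + t • w ∈ U :=
  h.convex.add_smul_mem hz hw ht

lemma exists_taylor (h : IsConvexBarrier F U) {z w : V} (hz : z ∈ U) (hw : z + w ∈ U) :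
    ∃ t ∈ Set.Ioo (0 : ℝ) 1,
      F (z + w) = F z + fderiv ℝ F z w + fderiv ℝ (fderiv ℝ F) (z + t • w) w w / 2 := by
  have hline : ∀ t : ℝ, HasDerivAt (fun t : ℝ => z + t • w) w t := fun t => by
    simpa using ((hasDerivAt_id t).smul_const w).const_add z
  have := exists_taylor_two (φ := fun t => F (z + t • w))
    (φ' := fun t => fderiv ℝ F (z + t • w) w)
    (φ'' := fun t => fderiv ℝ (fderiv ℝ F) (z + t • w) w w)
    (fun t ht => (h.hasFDerivAt (h.add_smul_mem hz hw ht)).comp_hasDerivAt t (hline t))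
    (fun t ht => by
      have := (h.hasFDerivAt_fderiv (h.add_smul_mem hz hw ht)).comp_hasDerivAt t (hline t)
      simpa using this.clm_apply (hasDerivAt_const t w))
  simpa using this

/-- In Taylor's formula the linear term vanishes and the quadratic one is positive. This gives
uniqueness of both the minimizer and the critical point. -/
lemma lt_of_ne (h : IsConvexBarrier F U) {z w : V} (hz : z ∈ U) (hw : w ∈ U) (hne : w ≠ z)
    (hg : fderiv ℝ F z = 0) : F z < F w := by
  have e : z + (w - z) = w := by abel
  obtain ⟨t, ht, heq⟩ := h.exists_taylor (w := w - z) hz (by rwa [e])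
  have := h.pos (z + t • (w - z)) (h.add_smul_mem hz (by rwa [e]) ⟨ht.1.le, ht.2.le⟩) (w - z)
    (sub_ne_zero.2 hne)
  rw [e, hg] at heq
  simp only [_root_.zero_apply, add_zero] at heq
  linarith

lemma exists_minimizer (h : IsConvexBarrier F U) (hne : U.Nonempty) :
    ∃ z ∈ U, fderiv ℝ F z = 0 := by
  obtain ⟨z₀, hz₀⟩ := hne
  obtain ⟨z, hz, hmin⟩ := (h.compact (F z₀)).exists_isMinOn ⟨z₀, hz₀, le_rfl⟩
    (fun y hy => (h.contDiffAt y hy.1).continuousAt.continuousWithinAt)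
  refine ⟨z, hz.1, IsLocalMin.fderiv_eq_zero ?_⟩
  filter_upwards [h.isOpen.mem_nhds hz.1] with y hy
  by_cases hc : F y ≤ F z₀
  · exact hmin ⟨hy, hc⟩
  · exact (hz.2.trans (not_le.1 hc).le)

lemma _root_.DampedNewton.Step.mem {σ : ℝ} {z z' : V} (hs : Step F U σ z z') : z' ∈ U := by
  obtain ⟨d, α, -, hα, rfl⟩ := hs
  exact hα.1.2.1

lemma step_le (h : IsConvexBarrier F U) {σ : ℝ} (hσ : 0 < σ) {z z' : V} (hz : z ∈ U)
    (hs : Step F U σ z z') : F z' ≤ F z := by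
  obtain ⟨d, α, hd, hα, rfl⟩ := hs
  have h1 := hα.1.2.2
  obtain ⟨m, hm⟩ := hα.1.1
  have hα0 : 0 < α := by rw [hm]; positivity
  have h2 : fderiv ℝ F z d = -fderiv ℝ (fderiv ℝ F) z d d := by rw [hd]; simp
  have h3 : 0 ≤ fderiv ℝ (fderiv ℝ F) z d d := by
    rcases eq_or_ne d 0 with rfl | h0
    · simp
    · exact (h.pos z hz d h0).le
  rw [h2] at h1
  have := mul_nonneg (mul_pos hσ hα0).le h3
  linarith

variable [FiniteDimensional ℝ V]

/-- The quadratic form attains a positive minimum on the compact unit sphere; homogeneity does the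
rest. -/
lemma exists_coercive (h : IsConvexBarrier F U) {z : V} (hz : z ∈ U) :
    ∃ c > 0, ∀ u : V, c * ‖u‖ ^ 2 ≤ fderiv ℝ (fderiv ℝ F) z u u := by
  have := FiniteDimensional.proper_real V
  -- The sphere is empty when `V` is trivial.
  rcases (Metric.sphere (0 : V) 1).eq_empty_or_nonempty with he | hne
  · refine ⟨1, one_pos, fun u => ?_⟩
    have : u = 0 := by
      by_contra hu
      have : (‖u‖⁻¹ • u) ∈ Metric.sphere (0 : V) 1 := by
        simp [norm_smul, inv_mul_cancel₀ (norm_ne_zero_iff.2 hu)]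
      simp [he] at this
    simp [this]
  · obtain ⟨v, hv, hmin⟩ := (isCompact_sphere (0 : V) 1).exists_isMinOn hne
      (f := fun u => fderiv ℝ (fderiv ℝ F) z u u) (by fun_prop)
    have hv0 : v ≠ 0 := by rintro rfl; simp at hv
    refine ⟨_, h.pos z hz v hv0, fun u => ?_⟩
    rcases eq_or_ne u 0 with rfl | hu
    · simp
    have hm : (‖u‖⁻¹ • u) ∈ Metric.sphere (0 : V) 1 := by
      simp [norm_smul, inv_mul_cancel₀ (norm_ne_zero_iff.2 hu)]
    have := isMinOn_iff.1 hmin _ hm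
    simp only [map_smul, _root_.smul_apply, smul_eq_mul] at this
    have hp : 0 < ‖u‖ := norm_pos_iff.2 hu
    calc _ ≤ (‖u‖⁻¹ * (‖u‖⁻¹ * fderiv ℝ (fderiv ℝ F) z u u)) * ‖u‖ ^ 2 := by gcongr
      _ = _ := by field_simp

/-- Near a point of `U` the second derivative is uniformly coercive, bounded and Lipschitz. -/
lemma exists_local_bounds (h : IsConvexBarrier F U) {z : V} (hz : z ∈ U) :
    ∃ r > 0, ∃ c > 0, ∃ L > 0, Metric.ball z r ⊆ U ∧
      (∀ y ∈ Metric.ball z r, ∀ u : V, c * ‖u‖ ^ 2 ≤ fderiv ℝ (fderiv ℝ F) y u u) ∧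
      (∀ y ∈ Metric.ball z r, ‖fderiv ℝ (fderiv ℝ F) y‖ ≤ L) ∧
      (∀ y ∈ Metric.ball z r, ∀ x ∈ Metric.ball z r,
        ‖fderiv ℝ (fderiv ℝ F) y - fderiv ℝ (fderiv ℝ F) x‖ ≤ L * ‖y - x‖) := by
  obtain ⟨c, hc, hcoer⟩ := h.exists_coercive hz
  obtain ⟨K, s, hs, hK⟩ := (h.contDiffAt_fderiv_fderiv hz).exists_lipschitzOnWith
  have hcont := (h.contDiffAt_fderiv_fderiv hz).continuousAt
  have hnear := hcont.eventually (Metric.ball_mem_nhds _ (half_pos hc))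
  obtain ⟨r, hr, hball⟩ := Metric.mem_nhds_iff.1
    (Filter.inter_mem (Filter.inter_mem hs (h.isOpen.mem_nhds hz)) hnear)
  -- A perturbation of operator norm below `c / 2` costs at most half of the coercivity constant.
  -- The last constant is a sum so that it serves both as a bound and as a Lipschitz constant.
  refine ⟨r, hr, c / 2, half_pos hc, K + (‖fderiv ℝ (fderiv ℝ F) z‖ + c / 2), by positivity,
    fun y hy => (hball hy).1.2, fun y hy u => ?_, fun y hy => ?_, fun y hy x hx => ?_⟩
  · have h1 : ‖fderiv ℝ (fderiv ℝ F) y - fderiv ℝ (fderiv ℝ F) z‖ < c / 2 := by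
      simpa [dist_eq_norm] using (hball hy).2
    have h2 := (fderiv ℝ (fderiv ℝ F) y - fderiv ℝ (fderiv ℝ F) z).le_opNorm₂ u u
    have h3 := abs_le.1 ((Real.norm_eq_abs _).symm.le.trans h2)
    simp only [_root_.sub_apply] at h3
    have := hcoer u
    nlinarith [norm_nonneg u, sq_nonneg ‖u‖, h3.1]
  · have h1 : ‖fderiv ℝ (fderiv ℝ F) y - fderiv ℝ (fderiv ℝ F) z‖ < c / 2 := by
      simpa [dist_eq_norm] using (hball hy).2
    have := norm_le_norm_add_norm_sub' (fderiv ℝ (fderiv ℝ F) y) (fderiv ℝ (fderiv ℝ F) z)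
    have : (0 : ℝ) ≤ K := K.2
    linarith
  · refine (hK.norm_sub_le (hball hy).1.1 (hball hx).1.1).trans ?_
    gcongr
    have := norm_nonneg (fderiv ℝ (fderiv ℝ F) z)
    linarith

lemma existsUnique_direction (h : IsConvexBarrier F U) {z : V} (hz : z ∈ U) :
    ∃! d : V, fderiv ℝ (fderiv ℝ F) z d = -fderiv ℝ F z := by
  set H := fderiv ℝ (fderiv ℝ F) z
  have hinj : Function.Injective H := by
    refine (injective_iff_map_eq_zero H).2 fun u hu => ?_
    by_contra hne
    have := h.pos z hz u hne
    rw [show fderiv ℝ (fderiv ℝ F) z u = 0 from hu] at this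
    simp at this
  -- An injective linear map from `V` to its dual is onto, since the dimensions agree.
  let T : V →ₗ[ℝ] Module.Dual ℝ V :=
    (ContinuousLinearMap.coeLM ℝ : (V →L[ℝ] ℝ) →ₗ[ℝ] V →ₗ[ℝ] ℝ) ∘ₗ H.toLinearMap
  have hTinj : Function.Injective T :=
    (ContinuousLinearMap.coe_injective (R₁ := ℝ) (σ₁₂ := RingHom.id ℝ)).comp hinj
  have hsurj := (LinearMap.injective_iff_surjective_of_finrank_eq_finrank
    (Subspace.dual_finrank_eq (K := ℝ) (V := V)).symm).1 hTinj
  obtain ⟨d, hd⟩ := hsurj ((-fderiv ℝ F z : V →L[ℝ] ℝ) : V →ₗ[ℝ] ℝ)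
  refine ⟨d, ContinuousLinearMap.coe_injective hd, fun y hy => hinj (hy.trans ?_)⟩
  exact (ContinuousLinearMap.coe_injective hd).symm

/-- Near a point of `U`, some fixed power of `1 / 2` is an admissible step size for every Newton
direction. -/
lemma exists_uniform_armijo (h : IsConvexBarrier F U) {σ : ℝ} (hσ : σ < 1) {z : V} (hz : z ∈ U) :
    ∃ r > 0, ∃ m : ℕ, ∀ y ∈ Metric.ball z r, ∀ d : V,
      fderiv ℝ (fderiv ℝ F) y d = -fderiv ℝ F y →
      y ∈ U ∧ (1 / 2 ^ m : ℝ) ∈ armijoSteps F U σ y d := by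
  obtain ⟨r, hr, c, hc, L, hL, hball, hcoer, hbd, -⟩ := h.exists_local_bounds hz
  have hgc := ((h.contDiffAt_fderiv hz).continuousAt.norm).eventually
    (gt_mem_nhds (lt_add_one ‖fderiv ℝ F z‖))
  obtain ⟨r', hr', hg⟩ := Metric.eventually_nhds_iff_ball.1 hgc
  set N := ‖fderiv ℝ F z‖ + 1 with hN
  have hNpos : 0 < N := by positivity
  have hσ1 : 0 < 1 - σ := by linarith
  -- As `‖d‖ ≤ N / c` below, the first bound keeps the whole segment in the ball of radius `r`; the
  -- second makes the quadratic Taylor term smaller than the slack `1 - σ` of the Armijo test.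
  obtain ⟨m, hm⟩ := exists_pow_lt_of_lt_one
    (lt_min (show 0 < r / 2 / (N / c) by positivity) (show 0 < (1 - σ) * c / L by positivity))
    (show (1 / 2 : ℝ) < 1 by norm_num)
  refine ⟨min (r / 2) r', lt_min (half_pos hr) hr', m, fun y hy d hd => ?_⟩
  have hy1 : y ∈ Metric.ball z (r / 2) := Metric.ball_subset_ball (min_le_left _ _) hy
  have hy2 : y ∈ Metric.ball z r := Metric.ball_subset_ball (by linarith) hy1
  have hyU := hball hy2
  have hgy := hg y (Metric.ball_subset_ball (min_le_right _ _) hy)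
  set α : ℝ := 1 / 2 ^ m with hα
  have hαm : α = (1 / 2) ^ m := by rw [hα, one_div_pow]
  rw [← hαm, lt_min_iff, lt_div_iff₀ (by positivity), lt_div_iff₀ hL] at hm
  have hα0 : 0 < α := by positivity
  have hquad : fderiv ℝ F y d = -fderiv ℝ (fderiv ℝ F) y d d := by rw [hd]; simp
  have hdn : ‖d‖ ≤ N / c := by
    rw [le_div_iff₀ hc]
    have h1 := hcoer y hy2 d
    have h2 := (fderiv ℝ F y).le_opNorm d
    have h3 := neg_le_of_abs_le ((Real.norm_eq_abs _).symm.le.trans h2)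
    rcases (norm_nonneg d).eq_or_lt with h0 | h0
    · rw [← h0]; simp [hNpos.le]
    · refine le_of_mul_le_mul_right ?_ h0
      nlinarith
  have hmem : ∀ t ∈ Set.Icc (0 : ℝ) 1, y + t • (α • d) ∈ Metric.ball z r := by
    intro t ht
    have h1 : ‖t • (α • d)‖ < r / 2 := by
      rw [norm_smul, norm_smul, Real.norm_of_nonneg ht.1, Real.norm_of_nonneg hα0.le]
      calc t * (α * ‖d‖) ≤ 1 * (α * (N / c)) := by gcongr; exact ht.2
        _ < r / 2 := by linarith [hm.1]
    rw [Metric.mem_ball, dist_eq_norm] at hy1 ⊢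
    calc ‖y + t • (α • d) - z‖ = ‖(y - z) + t • (α • d)‖ := by congr 1; abel
      _ ≤ ‖y - z‖ + ‖t • (α • d)‖ := norm_add_le _ _
      _ < r := by linarith
  have hU1 : y + α • d ∈ U := by simpa using hball (hmem 1 (by simp))
  refine ⟨hyU, ⟨m, rfl⟩, hU1, ?_⟩
  obtain ⟨t, ht, heq⟩ := h.exists_taylor hyU hU1
  have hHt := hbd _ (hmem t ⟨ht.1.le, ht.2.le⟩)
  rw [heq]
  simp only [map_smul, _root_.smul_apply, smul_eq_mul]
  set A := fderiv ℝ (fderiv ℝ F) (y + t • α • d) d d with hA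
  have hAle : A ≤ L * ‖d‖ ^ 2 := by
    have h2 := (fderiv ℝ (fderiv ℝ F) (y + t • α • d)).le_opNorm₂ d d
    have := le_of_abs_le ((Real.norm_eq_abs _).symm.le.trans h2)
    calc A ≤ _ := this
      _ ≤ L * ‖d‖ * ‖d‖ := by gcongr
      _ = _ := by ring
  have hQ := hcoer y hy2 d
  have h5 : α * A / 2 ≤ (1 - σ) * fderiv ℝ (fderiv ℝ F) y d d := by
    have : 0 ≤ ‖d‖ ^ 2 := by positivity
    calc α * A / 2 ≤ α * (L * ‖d‖ ^ 2) / 2 := by gcongr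
      _ ≤ (α * L) * ‖d‖ ^ 2 := by nlinarith [mul_nonneg (mul_nonneg hα0.le hL.le) this]
      _ ≤ ((1 - σ) * c) * ‖d‖ ^ 2 := mul_le_mul_of_nonneg_right hm.2.le this
      _ = (1 - σ) * (c * ‖d‖ ^ 2) := by ring
      _ ≤ _ := by gcongr
  have h6 := mul_le_mul_of_nonneg_left h5 hα0.le
  rw [hquad]
  nlinarith

lemma exists_isGreatest (h : IsConvexBarrier F U) {σ : ℝ} (hσ : σ < 1) {z d : V} (hz : z ∈ U)
    (hd : fderiv ℝ (fderiv ℝ F) z d = -fderiv ℝ F z) :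
    ∃ α, IsGreatest (armijoSteps F U σ z d) α := by
  classical
  obtain ⟨r, hr, m, hm⟩ := h.exists_uniform_armijo hσ hz
  have hex : ∃ m : ℕ, (1 / 2 ^ m : ℝ) ∈ armijoSteps F U σ z d :=
    ⟨m, (hm z (Metric.mem_ball_self hr) d hd).2⟩
  -- The least admissible exponent gives the greatest step.
  refine ⟨1 / 2 ^ Nat.find hex, Nat.find_spec hex, ?_⟩
  rintro _ ⟨⟨k, rfl⟩, hk⟩
  have : Nat.find hex ≤ k := Nat.find_min' hex ⟨⟨k, rfl⟩, hk⟩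
  exact one_div_le_one_div_of_le (by positivity) (pow_le_pow_right₀ (by norm_num) this)

lemma existsUnique_step (h : IsConvexBarrier F U) {σ : ℝ} (hσ : σ < 1) {z : V} (hz : z ∈ U) :
    ∃! z', Step F U σ z z' := by
  obtain ⟨d, hd, hdu⟩ := h.existsUnique_direction hz
  obtain ⟨α, hα⟩ := h.exists_isGreatest hσ hz hd
  refine ⟨z + α • d, ⟨d, α, hd, hα, rfl⟩, ?_⟩
  rintro _ ⟨d', α', hd', hα', rfl⟩
  obtain rfl := hdu _ hd'
  rw [hα'.unique hα]

/-- Near a noncritical point every step decreases the function by at least a fixed amount. -/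
lemma exists_uniform_decrease (h : IsConvexBarrier F U) {σ : ℝ} (hσ : σ ∈ Set.Ioo (0 : ℝ) 1)
    {z : V} (hz : z ∈ U) (hg : fderiv ℝ F z ≠ 0) :
    ∃ r > 0, ∃ η > 0, ∀ y ∈ Metric.ball z r, ∀ y', Step F U σ y y' → F y' ≤ F y - η := by
  obtain ⟨r₁, hr₁, m, hm⟩ := h.exists_uniform_armijo hσ.2 hz
  obtain ⟨r₂, hr₂, c, hc, L, hL, -, hcoer, hbd, -⟩ := h.exists_local_bounds hz
  have hN : 0 < ‖fderiv ℝ F z‖ := norm_pos_iff.2 hg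
  obtain ⟨r₃, hr₃, hg3⟩ := Metric.eventually_nhds_iff_ball.1
    (((h.contDiffAt_fderiv hz).continuousAt.norm).eventually (lt_mem_nhds (half_lt_self hN)))
  set N := ‖fderiv ℝ F z‖ / 2
  have hNpos : 0 < N := half_pos hN
  have hσ0 := hσ.1
  -- The Armijo test guarantees a decrease of `σ α` times the Hessian form at `d`. Here `α ≥ 2⁻ᵐ`,
  -- and `‖d‖ ≥ N / L` because the gradient has norm above `N` and the Hessian norm at most `L`.
  refine ⟨min r₁ (min r₂ r₃), by positivity, σ * (1 / 2 ^ m) * (c * (N / L) ^ 2), by positivity,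
    fun y hy y' hs => ?_⟩
  simp only [Metric.mem_ball, lt_min_iff] at hy
  obtain ⟨d, α, hd, hα, rfl⟩ := hs
  have h1 := hα.1.2.2
  have h2 : fderiv ℝ F y d = -fderiv ℝ (fderiv ℝ F) y d d := by rw [hd]; simp
  have h3 : (1 / 2 ^ m : ℝ) ≤ α := hα.2 (hm y hy.1 d hd).2
  have h4 := hcoer y hy.2.1 d
  have h5 : N / L ≤ ‖d‖ := by
    rw [div_le_iff₀ hL]
    have h6 := (fderiv ℝ (fderiv ℝ F) y).le_opNorm d
    rw [hd, norm_neg] at h6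
    have h7 := hg3 y hy.2.2
    have h8 := hbd y hy.2.1
    nlinarith [norm_nonneg d]
  have h9 : c * (N / L) ^ 2 ≤ fderiv ℝ (fderiv ℝ F) y d d := le_trans (by gcongr) h4
  have h10 : σ * (1 / 2 ^ m) * (c * (N / L) ^ 2) ≤ σ * α * fderiv ℝ (fderiv ℝ F) y d d := by
    have : 0 ≤ α := le_trans (by positivity) h3
    gcongr
  rw [h2] at h1
  linarith

/-- The values decrease and are bounded below, so the decrements tend to zero. On the sublevel set
minus a ball around `zs`, compactness gives a uniform positive decrement, so the iterates eventually
stay in the ball. -/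
lemma tendsto_of_step (h : IsConvexBarrier F U) {σ : ℝ} (hσ : σ ∈ Set.Ioo (0 : ℝ) 1) {zs : V}
    (hzs : zs ∈ U) (hg : fderiv ℝ F zs = 0) {z : ℕ → V} (h0 : z 0 ∈ U)
    (hs : ∀ t, Step F U σ (z t) (z (t + 1))) : Tendsto z atTop (𝓝 zs) := by
  have hU : ∀ t, z t ∈ U := fun t => by
    cases t with
    | zero => exact h0
    | succ t => exact (hs t).mem
  have hanti : Antitone fun t => F (z t) :=
    antitone_nat_of_succ_le fun t => h.step_le hσ.1 (hU t) (hs t)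
  have hbdd : BddBelow (Set.range fun t => F (z t)) := by
    refine ⟨F zs, ?_⟩
    rintro _ ⟨t, rfl⟩
    by_cases he : z t = zs
    · simp [he]
    · exact (h.lt_of_ne hzs (hU t) he hg).le
  have hlim := tendsto_atTop_ciInf hanti hbdd
  have hdiff : Tendsto (fun t => F (z t) - F (z (t + 1))) atTop (𝓝 0) := by
    simpa using hlim.sub ((tendsto_add_atTop_iff_nat 1).2 hlim)
  rw [Metric.tendsto_atTop']
  intro ε hε
  set K := {y | y ∈ U ∧ F y ≤ F (z 0)} \ Metric.ball zs ε with hK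
  have hKc : IsCompact K := (h.compact _).diff Metric.isOpen_ball
  have key : ∃ η > 0, ∀ y ∈ K, ∀ y', Step F U σ y y' → F y' ≤ F y - η := by
    refine hKc.induction_on (p := fun s => ∃ η > 0, ∀ y ∈ s, ∀ y', Step F U σ y y' → F y' ≤ F y - η)
      ⟨1, one_pos, by simp⟩ ?_ ?_ ?_
    · rintro s t hst ⟨η, hη, hh⟩
      exact ⟨η, hη, fun y hy => hh y (hst hy)⟩
    · rintro s t ⟨η, hη, hh⟩ ⟨η', hη', hh'⟩
      refine ⟨min η η', lt_min hη hη', ?_⟩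
      rintro y (hy | hy) y' hy'
      · linarith [hh y hy y' hy', min_le_left η η']
      · linarith [hh' y hy y' hy', min_le_right η η']
    · intro y hy
      have hgy : fderiv ℝ F y ≠ 0 := fun hgy => by
        have hne : y ≠ zs := by
          rintro rfl
          exact hy.2 (Metric.mem_ball_self hε)
        exact lt_asymm (h.lt_of_ne hzs hy.1.1 hne hg) (h.lt_of_ne hy.1.1 hzs hne.symm hgy)
      obtain ⟨r, hr, η, hη, hh⟩ := h.exists_uniform_decrease hσ hy.1.1 hgy
      exact ⟨_, mem_nhdsWithin_of_mem_nhds (Metric.ball_mem_nhds y hr), η, hη, hh⟩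
  obtain ⟨η, hη, hh⟩ := key
  obtain ⟨T, hT⟩ := eventually_atTop.1 (hdiff.eventually (gt_mem_nhds hη))
  refine ⟨T, fun t ht => ?_⟩
  by_contra hcon
  have := hh (z t) ⟨⟨hU t, hanti (Nat.zero_le t)⟩, hcon⟩ _ (hs t)
  have := hT t ht.le
  linarith

lemma exists_quadratic (h : IsConvexBarrier F U) {σ : ℝ} (hσ : σ ∈ Set.Ioo (0 : ℝ) (1 / 2)) {zs : V}
    (hzs : zs ∈ U) (hg : fderiv ℝ F zs = 0) :
    ∃ ε > 0, ∃ C > 0, ∀ z z', Step F U σ z z' → ‖z - zs‖ < ε → ‖z' - zs‖ ≤ C * ‖z - zs‖ ^ 2 := by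
  obtain ⟨r, hr, c, hc, L, hL, hball, hcoer, hbd, hlip⟩ := h.exists_local_bounds hzs
  have hσ2 : 0 < 1 / 2 - σ := by linarith [hσ.2]
  set C : ℝ := 2 * L / c with hC
  have hCpos : 0 < C := by positivity
  -- The three bounds ensure that `z` lies within `r / 2` of `zs`, that `‖d‖ < r / 2`, and that the
  -- Hessian varies by at most `(1/2 - σ) c` along the step.
  set ε := min (min (r / 2) (r / (2 * (C * r + 1)))) ((1 / 2 - σ) * c / (L * (C * r + 1))) with hε
  have hεpos : 0 < ε := by positivity
  refine ⟨ε, hεpos, C, hCpos, ?_⟩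
  rintro z _ ⟨d, α, hd, hα, rfl⟩ hzε
  obtain ⟨⟨h1, h2⟩, h3⟩ : (‖z - zs‖ < r / 2 ∧ ‖z - zs‖ < r / (2 * (C * r + 1))) ∧
      ‖z - zs‖ < (1 / 2 - σ) * c / (L * (C * r + 1)) := by
    simpa [hε, lt_min_iff] using hzε
  set q := ‖z - zs‖ with hq
  have hq0 : 0 ≤ q := norm_nonneg _
  have hzb : z ∈ Metric.ball zs r := by rw [Metric.mem_ball, dist_eq_norm]; linarith
  have hzU := hball hzb
  -- The full Newton step is quadratically accurate.
  have hnewton : ‖z + d - zs‖ ≤ C * q ^ 2 := by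
    set e := z + d - zs with he
    have hsub : Metric.closedBall zs q ⊆ Metric.ball zs r :=
      Metric.closedBall_subset_ball (by linarith)
    -- Mean value inequality for the gradient with the Hessian at `z` subtracted: points of the
    -- closed ball are within `2 * q` of `z`. This and coercivity produce `C = 2L / c`.
    have hmv := (convex_closedBall zs q).norm_image_sub_le_of_norm_hasFDerivWithin_le'
      (𝕜 := ℝ) (f := fderiv ℝ F) (f' := fderiv ℝ (fderiv ℝ F)) (φ := fderiv ℝ (fderiv ℝ F) z)
      (C := L * (2 * q)) (x := zs) (y := z)
      (fun x hx => (h.hasFDerivAt_fderiv (hball (hsub hx))).hasFDerivWithinAt)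
      (fun x hx => (hlip x (hsub hx) z hzb).trans (by
        gcongr
        have : ‖x - zs‖ ≤ q := by simpa [dist_eq_norm] using hx
        calc ‖x - z‖ = ‖(x - zs) - (z - zs)‖ := by congr 1; abel
          _ ≤ ‖x - zs‖ + ‖z - zs‖ := norm_sub_le _ _
          _ ≤ 2 * q := by linarith))
      (Metric.mem_closedBall_self hq0) (by simp [dist_eq_norm, hq])
    have hee : fderiv ℝ (fderiv ℝ F) z e =
        -(fderiv ℝ F z - fderiv ℝ F zs - fderiv ℝ (fderiv ℝ F) z (z - zs)) := by
      rw [hg, he, show z + d - zs = d + (z - zs) by abel, map_add, hd]; abel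
    have h4 : ‖fderiv ℝ (fderiv ℝ F) z e‖ ≤ L * (2 * q) * q := by rw [hee, norm_neg]; exact hmv
    have h5 := hcoer z hzb e
    have h6 := (fderiv ℝ (fderiv ℝ F) z e).le_opNorm e
    have h7 := le_of_abs_le ((Real.norm_eq_abs _).symm.le.trans h6)
    have h8 : c * ‖e‖ ≤ L * (2 * q) * q := by
      rcases (norm_nonneg e).eq_or_lt with h0 | h0
      · rw [← h0]; simp; positivity
      · refine le_of_mul_le_mul_right ?_ h0
        nlinarith
    rw [hC, div_mul_eq_mul_div, le_div_iff₀ hc]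
    linarith
  have hqr : C * q ^ 2 ≤ C * r * q := by
    have : q ≤ r := by linarith
    nlinarith [mul_nonneg hCpos.le hq0]
  have hdn : ‖d‖ ≤ (C * r + 1) * q := by
    calc ‖d‖ = ‖(z + d - zs) - (z - zs)‖ := by congr 1; abel
      _ ≤ ‖z + d - zs‖ + ‖z - zs‖ := norm_sub_le _ _
      _ ≤ _ := by linarith
  have hCr : 0 < C * r + 1 := by positivity
  have hdr : ‖d‖ < r / 2 := by
    rw [lt_div_iff₀ (by positivity)] at h2
    linarith
  have hmem : ∀ t ∈ Set.Icc (0 : ℝ) 1, z + t • d ∈ Metric.ball zs r := by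
    intro t ht
    have : ‖t • d‖ ≤ ‖d‖ := by
      rw [norm_smul, Real.norm_of_nonneg ht.1]
      exact mul_le_of_le_one_left (norm_nonneg _) ht.2
    rw [Metric.mem_ball, dist_eq_norm]
    calc ‖z + t • d - zs‖ = ‖(z - zs) + t • d‖ := by congr 1; abel
      _ ≤ ‖z - zs‖ + ‖t • d‖ := norm_add_le _ _
      _ < r := by linarith
  have hU1 : z + d ∈ U := by simpa using hball (hmem 1 (by simp))
  have hquad : fderiv ℝ F z d = -fderiv ℝ (fderiv ℝ F) z d d := by rw [hd]; simp
  -- With `Q` the Hessian form at `z` and `Q'` the one at the Taylor point, both evaluated at `d`,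
  -- the test reads `Q' / 2 ≤ (1 - σ) Q`; it follows from `Q' - Q ≤ (1/2 - σ) Q`.
  have hfull : (1 : ℝ) ∈ armijoSteps F U σ z d := by
    refine ⟨⟨0, by simp⟩, by simpa using hU1, ?_⟩
    obtain ⟨t, ht, heq⟩ := h.exists_taylor hzU hU1
    have h4 := hlip _ (hmem t ⟨ht.1.le, ht.2.le⟩) z hzb
    have h5 : ‖z + t • d - z‖ ≤ ‖d‖ := by
      rw [add_sub_cancel_left, norm_smul, Real.norm_of_nonneg ht.1.le]
      exact mul_le_of_le_one_left (norm_nonneg _) ht.2.le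
    have h6 := (fderiv ℝ (fderiv ℝ F) (z + t • d) - fderiv ℝ (fderiv ℝ F) z).le_opNorm₂ d d
    have h7 := le_of_abs_le ((Real.norm_eq_abs _).symm.le.trans h6)
    simp only [_root_.sub_apply] at h7
    have h8 : ‖fderiv ℝ (fderiv ℝ F) (z + t • d) - fderiv ℝ (fderiv ℝ F) z‖ ≤ (1 / 2 - σ) * c := by
      refine h4.trans ?_
      rw [lt_div_iff₀ (by positivity)] at h3
      calc L * ‖z + t • d - z‖ ≤ L * ((C * r + 1) * q) := by gcongr; exact h5.trans hdn
        _ ≤ _ := by linarith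
    have h9 : ‖fderiv ℝ (fderiv ℝ F) (z + t • d) - fderiv ℝ (fderiv ℝ F) z‖ * ‖d‖ * ‖d‖ ≤
        (1 / 2 - σ) * fderiv ℝ (fderiv ℝ F) z d d := by
      calc _ ≤ (1 / 2 - σ) * c * ‖d‖ * ‖d‖ := by gcongr
        _ = (1 / 2 - σ) * (c * ‖d‖ ^ 2) := by ring
        _ ≤ _ := by gcongr; exact hcoer z hzb d
    have h10 : 0 ≤ (1 / 2 - σ) * fderiv ℝ (fderiv ℝ F) z d d := le_trans (by positivity) h9
    rw [one_smul, heq, hquad]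
    linarith
  have hα1 : α = 1 := by
    refine le_antisymm ?_ (hα.2 hfull)
    obtain ⟨m, rfl⟩ := hα.1.1
    exact div_le_one_of_le₀ (one_le_pow₀ (by norm_num)) (by positivity)
  rw [hα1, one_smul]
  exact hnewton

end IsConvexBarrier

end DampedNewton

/-! ### Positive definite matrices, and derivatives of the inverse and of `log det`. -/

namespace Matrix

open scoped Matrix.Norms.Frobenius

variable {n : Type*} [Fintype n]

/-- The quadratic form is positive on the compact unit sphere and stays so under small
perturbations. Symmetry is not an open condition, hence the Hermitian premise. -/
lemma PosDef.eventually_posDef {A : Matrix n n ℝ} (hA : A.PosDef) :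
    ∀ᶠ B in 𝓝 A, B.IsHermitian → B.PosDef := by
  have hK := isCompact_sphere (0 : n → ℝ) 1
  have key : ∀ᶠ B in 𝓝 A, ∀ x ∈ Metric.sphere (0 : n → ℝ) 1, 0 < x ⬝ᵥ B *ᵥ x := by
    refine hK.eventually_forall_of_forall_eventually (P := fun B x => 0 < x ⬝ᵥ B *ᵥ x) fun x hx => ?_
    have hc : Continuous fun q : Matrix n n ℝ × (n → ℝ) => q.2 ⬝ᵥ q.1 *ᵥ q.2 :=
      continuous_snd.dotProduct (continuous_fst.matrix_mulVec continuous_snd)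
    refine hc.continuousAt.eventually (lt_mem_nhds ?_)
    have hx0 : x ≠ 0 := by rintro rfl; simp at hx
    simpa using hA.dotProduct_mulVec_pos hx0
  filter_upwards [key] with B hB hBh
  refine PosDef.of_dotProduct_mulVec_pos hBh fun x hx => ?_
  have hn : 0 < ‖x‖ := norm_pos_iff.2 hx
  have h1 := hB (‖x‖⁻¹ • x) (by simp [norm_smul, inv_mul_cancel₀ hn.ne'])
  rw [mulVec_smul, smul_dotProduct, dotProduct_smul, smul_eq_mul, smul_eq_mul] at h1
  have h2 : 0 < ‖x‖⁻¹ := inv_pos.2 hn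
  simpa using (mul_pos_iff_of_pos_left h2).1 ((mul_pos_iff_of_pos_left h2).1 h1)

lemma PosDef.exists_posSemidef_sub_smul_one [DecidableEq n] {A : Matrix n n ℝ} (hA : A.PosDef) :
    ∃ t : ℝ, 0 < t ∧ (A - t • (1 : Matrix n n ℝ)).PosSemidef := by
  have hc : Tendsto (fun t : ℝ => A - t • (1 : Matrix n n ℝ)) (𝓝[>] 0) (𝓝 A) := by
    have : Continuous fun t : ℝ => A - t • (1 : Matrix n n ℝ) := by fun_prop
    simpa using (this.tendsto 0).mono_left nhdsWithin_le_nhds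
  obtain ⟨t, h1, h2⟩ := ((hc.eventually hA.eventually_posDef).and self_mem_nhdsWithin).exists
  exact ⟨t, h2, (h1 (hA.isHermitian.sub (isHermitian_one.smul (IsSelfAdjoint.all t)))).posSemidef⟩

lemma PosSemidef.trace_mul_nonneg {A B : Matrix n n ℝ} (hA : A.PosSemidef) (hB : B.PosSemidef) :
    0 ≤ (A * B).trace := by
  classical
  open scoped MatrixOrder in
  -- With `B = C* C` the trace becomes that of the positive semidefinite matrix `C A C*`.
  obtain ⟨C, rfl⟩ := CStarAlgebra.nonneg_iff_eq_star_mul_self.1 hB.nonneg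
  rw [star_eq_conjTranspose, ← Matrix.mul_assoc, trace_mul_comm, ← Matrix.mul_assoc]
  exact (hA.mul_mul_conjTranspose_same C).trace_nonneg

lemma PosDef.exists_mul_trace_le [DecidableEq n] {A : Matrix n n ℝ} (hA : A.PosDef) :
    ∃ t : ℝ, 0 < t ∧ ∀ B : Matrix n n ℝ, B.PosSemidef → t * B.trace ≤ (A * B).trace := by
  obtain ⟨t, ht, h⟩ := hA.exists_posSemidef_sub_smul_one
  refine ⟨t, ht, fun B hB => ?_⟩
  have := h.trace_mul_nonneg hB
  rw [Matrix.sub_mul, trace_sub, smul_mul, Matrix.one_mul, trace_smul, smul_eq_mul] at this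
  linarith

lemma PosSemidef.det_le_trace_pow [DecidableEq n] {A : Matrix n n ℝ} (hA : A.PosSemidef) :
    A.det ≤ A.trace ^ Fintype.card n := by
  rw [hA.isHermitian.det_eq_prod_eigenvalues, hA.isHermitian.trace_eq_sum_eigenvalues]
  simp only [RCLike.ofReal_real_eq_id, id_eq]
  calc _ ≤ ∏ _i : n, ∑ j, hA.isHermitian.eigenvalues j :=
        Finset.prod_le_prod (fun i _ => hA.eigenvalues_nonneg i) fun i hi =>
          Finset.single_le_sum (fun j _ => hA.eigenvalues_nonneg j) hi
    _ = _ := by simp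

lemma isClosed_posSemidef : IsClosed {A : Matrix n n ℝ | A.PosSemidef} := by
  have : {A : Matrix n n ℝ | A.PosSemidef} =
      {A | Aᴴ = A} ∩ ⋂ x : n → ℝ, {A | 0 ≤ star x ⬝ᵥ A *ᵥ x} := by
    ext A
    simp [posSemidef_iff_dotProduct_mulVec, IsHermitian]
  rw [this]
  refine (isClosed_eq (by fun_prop) continuous_id).inter (isClosed_iInter fun x => ?_)
  exact isClosed_le continuous_const
    (continuous_const.dotProduct (continuous_id.matrix_mulVec continuous_const))

section Calculus

lemma contDiffAt_inv [DecidableEq n] {A : Matrix n n ℝ} (hA : A.det ≠ 0) {k : WithTop ℕ∞} :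
    ContDiffAt ℝ k (fun B : Matrix n n ℝ => B⁻¹) A := by
  obtain ⟨u, rfl⟩ := (isUnit_iff_isUnit_det A).2 hA.isUnit
  have := contDiffAt_ringInverse ℝ (n := k) u
  exact this.congr_of_eventuallyEq (.of_forall fun B => nonsing_inv_eq_ringInverse B)

lemma contDiff_apply (i j : n) {k : WithTop ℕ∞} :
    ContDiff ℝ k (fun B : Matrix n n ℝ => B i j) :=
  (LinearMap.toContinuousLinearMap (entryLinearMap ℝ ℝ i j)).contDiff

lemma contDiff_det [DecidableEq n] {k : WithTop ℕ∞} : ContDiff ℝ k (fun B : Matrix n n ℝ => B.det) := by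
  simp only [det_apply]
  refine ContDiff.sum fun τ _ => ContDiff.const_smul _ (contDiff_prod fun i _ => contDiff_apply _ _)

lemma contDiff_trace {k : WithTop ℕ∞} : ContDiff ℝ k (fun B : Matrix n n ℝ => B.trace) :=
  (LinearMap.toContinuousLinearMap (traceLinearMap n ℝ ℝ)).contDiff

lemma _root_.HasDerivAt.matrix_trace {f : ℝ → Matrix n n ℝ} {f' : Matrix n n ℝ} {t : ℝ}
    (hf : HasDerivAt f f' t) : HasDerivAt (fun s => (f s).trace) f'.trace t :=
  (LinearMap.toContinuousLinearMap (traceLinearMap n ℝ ℝ)).hasFDerivAt.comp_hasDerivAt t hf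

lemma hasDerivAt_line (A B : Matrix n n ℝ) : HasDerivAt (fun t : ℝ => A + t • B) B 0 := by
  exact (((hasDerivAt_id (0 : ℝ)).smul_const B).const_add A).congr_deriv (one_smul ℝ B)

lemma hasDerivAt_inv_line [DecidableEq n] {A : Matrix n n ℝ} (hA : A.det ≠ 0) (B : Matrix n n ℝ) :
    HasDerivAt (fun t : ℝ => (A + t • B)⁻¹) (-(A⁻¹ * B * A⁻¹)) 0 := by
  obtain ⟨u, rfl⟩ := (isUnit_iff_isUnit_det A).2 hA.isUnit
  have h := hasFDerivAt_ringInverse (𝕜 := ℝ) u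
  have h2 := h.comp_hasDerivAt_of_eq (0 : ℝ) (hasDerivAt_line (u : Matrix n n ℝ) B) (by simp)
  simp only [nonsing_inv_eq_ringInverse]
  refine h2.congr_deriv ?_
  rw [Ring.inverse_unit]
  rfl

lemma hasDerivAt_log_det_line [DecidableEq n] {A : Matrix n n ℝ} (hA : 0 < A.det) (B : Matrix n n ℝ) :
    HasDerivAt (fun t : ℝ => Real.log (A + t • B).det) (A⁻¹ * B).trace 0 := by
  have h1 : HasDerivAt (fun t : ℝ => (A + t • B).det) (A.det * (A⁻¹ * B).trace) 0 := by
    have e : ∀ t : ℝ, (A + t • B).det = A.det * (1 + t • (A⁻¹ * B)).det := fun t => by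
      rw [← det_mul, Matrix.mul_add, Matrix.mul_one, Matrix.mul_smul, ← Matrix.mul_assoc,
        mul_nonsing_inv _ hA.ne'.isUnit, Matrix.one_mul]
    -- `1 + (A⁻¹ * B).trace * t + q(t) t²` is the expansion of `det (1 + t A⁻¹ B)`, so only the
    -- trace survives at `t = 0`.
    let q := (1 + (Polynomial.X : Polynomial ℝ) • (A⁻¹ * B).map Polynomial.C).det.divX.divX
    have h2 := ((hasDerivAt_id (0 : ℝ)).const_mul (A⁻¹ * B).trace).const_add 1
    have h3 := (q.hasDerivAt 0).mul ((hasDerivAt_id (0 : ℝ)).pow 2)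
    have e' : (fun t : ℝ => (A + t • B).det) =
        fun t => A.det * (1 + (A⁻¹ * B).trace * t + q.eval t * t ^ 2) := by
      funext t
      rw [e, det_one_add_smul]
    rw [e']
    exact ((h2.add h3).const_mul A.det).congr_deriv (by simp)
  have := h1.log (by simpa using hA.ne')
  refine this.congr_deriv ?_
  simp [hA.ne']

end Calculus

end Matrix

/-! ### First and second derivatives of the objective on the span of the feasible set. -/

noncomputable section

namespace WassersteinShrinkage

variable {p : ℕ}

/-- The linear span of the feasible set: pairs with a symmetric matrix that vanishes on `E`. -/
def directions (E : Set (Fin p × Fin p)) : Submodule ℝ (Pair p) where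
  carrier := {w | w.1.IsSymm ∧ ∀ i j, (i, j) ∈ E → w.1 i j = 0}
  add_mem' := fun ha hb => ⟨ha.1.add hb.1, fun i j h => by simp [ha.2 i j h, hb.2 i j h]⟩
  zero_mem' := ⟨Matrix.isSymm_zero, fun _ _ _ => rfl⟩
  smul_mem' := fun c _ ha => ⟨ha.1.smul c, fun i j h => by simp [ha.2 i j h]⟩

/-- The matrix `γ I - X`; it is linear in `(X, γ)`. -/
def gap (z : Pair p) : Matrix (Fin p) (Fin p) ℝ := z.2 • 1 - z.1

lemma gap_add_smul (z w : Pair p) (t : ℝ) : gap (z + t • w) = gap z + t • gap w := by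
  ext i j
  change (z.2 + t * w.2) * (1 : Matrix (Fin p) (Fin p) ℝ) i j - (z.1 i j + t * w.1 i j) =
    (z.2 * (1 : Matrix (Fin p) (Fin p) ℝ) i j - z.1 i j) +
      t * (w.2 * (1 : Matrix (Fin p) (Fin p) ℝ) i j - w.1 i j)
  ring

/-- The derivative of the objective at `z` in the direction `w`. -/
def gradForm (S : Matrix (Fin p) (Fin p) ℝ) (ρ : ℝ) (z w : Pair p) : ℝ :=
  -(z.1⁻¹ * w.1).trace + w.2 * (ρ ^ 2 - S.trace) + (2 * z.2 * w.2 * ((gap z)⁻¹ * S).trace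
    + z.2 ^ 2 * (-((gap z)⁻¹ * gap w * (gap z)⁻¹) * S).trace)

/-- The second derivative of the objective at `z` in the directions `u` and `w`. -/
def hessForm (S : Matrix (Fin p) (Fin p) ℝ) (z u w : Pair p) : ℝ :=
  (z.1⁻¹ * u.1 * z.1⁻¹ * w.1).trace + (2 * u.2 * w.2 * ((gap z)⁻¹ * S).trace
    + 2 * z.2 * w.2 * (-((gap z)⁻¹ * gap u * (gap z)⁻¹) * S).trace
    + (2 * z.2 * u.2 * (-((gap z)⁻¹ * gap w * (gap z)⁻¹) * S).trace
      + z.2 ^ 2 * (((gap z)⁻¹ * gap u * (gap z)⁻¹ * gap w * (gap z)⁻¹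
          + (gap z)⁻¹ * gap w * (gap z)⁻¹ * gap u * (gap z)⁻¹) * S).trace))

lemma objective_eq {S : Matrix (Fin p) (Fin p) ℝ} (hS : S.IsSymm) (ρ : ℝ) (z : Pair p) :
    objective S ρ z = -Real.log z.1.det + z.2 * (ρ ^ 2 - S.trace)
      + z.2 ^ 2 * ((gap z)⁻¹ * S).trace := by
  have : (((gap z)⁻¹)ᵀ * S).trace = ((gap z)⁻¹ * S).trace := by
    rw [← Matrix.trace_transpose, Matrix.transpose_mul, Matrix.transpose_transpose, hS.eq,
      Matrix.trace_mul_comm]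
  rw [← this]
  rfl

open scoped Matrix.Norms.Frobenius

lemma hasDerivAt_snd_line (z w : Pair p) : HasDerivAt (fun t : ℝ => (z + t • w).2) w.2 0 := by
  have := ((hasDerivAt_id (0 : ℝ)).mul_const w.2).const_add z.2
  simpa using this

lemma hasDerivAt_inv_gap_line {z : Pair p} (hz : (gap z).det ≠ 0) (w : Pair p) :
    HasDerivAt (fun t : ℝ => (gap (z + t • w))⁻¹) (-((gap z)⁻¹ * gap w * (gap z)⁻¹)) 0 := by
  simpa only [gap_add_smul] using Matrix.hasDerivAt_inv_line hz (gap w)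

lemma hasDerivAt_objective_line {S : Matrix (Fin p) (Fin p) ℝ} (hS : S.IsSymm) (ρ : ℝ) {z : Pair p}
    (h1 : 0 < z.1.det) (h2 : (gap z).det ≠ 0) (w : Pair p) :
    HasDerivAt (fun t : ℝ => objective S ρ (z + t • w)) (gradForm S ρ z w) 0 := by
  simp only [objective_eq hS]
  have hγ := hasDerivAt_snd_line z w
  have hR := ((hasDerivAt_inv_gap_line h2 w).mul_const S).matrix_trace
  refine (((Matrix.hasDerivAt_log_det_line h1 w.1).neg.add (hγ.mul_const (ρ ^ 2 - S.trace))).add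
    ((hγ.pow 2).mul hR)).congr_deriv ?_
  simp [gradForm]

lemma hasDerivAt_gradForm_line (S : Matrix (Fin p) (Fin p) ℝ) (ρ : ℝ) {z : Pair p}
    (h1 : 0 < z.1.det) (h2 : (gap z).det ≠ 0) (u w : Pair p) :
    HasDerivAt (fun t : ℝ => gradForm S ρ (z + t • u) w) (hessForm S z u w) 0 := by
  have hγ := hasDerivAt_snd_line z u
  have hR := hasDerivAt_inv_gap_line h2 u
  have hX := ((Matrix.hasDerivAt_inv_line h1.ne' u.1).mul_const w.1).matrix_trace
  have hA := ((hγ.const_mul 2).mul_const w.2).mul (hR.mul_const S).matrix_trace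
  have hB := (hγ.pow 2).mul (((((hR.mul_const (gap w)).mul hR).neg).mul_const S).matrix_trace)
  refine ((hX.neg.add_const (w.2 * (ρ ^ 2 - S.trace))).add (hA.add hB)).congr_deriv ?_
  simp only [hessForm, Pi.mul_apply, Pi.neg_apply, Pi.pow_apply, zero_smul, add_zero,
    Matrix.neg_mul, Matrix.mul_neg, Matrix.trace_neg, Matrix.trace_add, Matrix.add_mul,
    Matrix.mul_assoc, neg_add, neg_neg, Nat.cast_ofNat, Nat.add_one_sub_one, pow_one]

lemma contDiff_gap {k : WithTop ℕ∞} : ContDiff ℝ k (gap : Pair p → Matrix (Fin p) (Fin p) ℝ) :=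
  (contDiff_snd.smul contDiff_const).sub contDiff_fst

lemma contDiffAt_objective {S : Matrix (Fin p) (Fin p) ℝ} (hS : S.IsSymm) (ρ : ℝ) {z : Pair p}
    (h1 : 0 < z.1.det) (h2 : (gap z).det ≠ 0) {k : WithTop ℕ∞} :
    ContDiffAt ℝ k (objective S ρ) z := by
  have hlog : ContDiffAt ℝ k (fun z : Pair p => Real.log z.1.det) z :=
    (Matrix.contDiff_det.comp contDiff_fst).contDiffAt.log h1.ne'
  have hR : ContDiffAt ℝ k (fun z : Pair p => ((gap z)⁻¹ * S).trace) z :=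
    Matrix.contDiff_trace.contDiffAt.comp z
      (((Matrix.contDiffAt_inv h2).comp z contDiff_gap.contDiffAt).mul contDiffAt_const)
  rw [show objective S ρ = _ from funext (objective_eq hS ρ)]
  exact (hlog.neg.add (contDiff_snd.mul contDiff_const).contDiffAt).add
    ((contDiff_snd.pow 2).contDiffAt.mul hR)

/-- The feasible set as a subset of its linear span. -/
def feasibleSub (E : Set (Fin p × Fin p)) : Set (directions E) :=
  {v | (gap (v : Pair p)).PosDef ∧ (v : Pair p).1.PosDef}

variable {E : Set (Fin p × Fin p)}

lemma isHermitian_of_isSymm {A : Matrix (Fin p) (Fin p) ℝ} (h : A.IsSymm) : A.IsHermitian := by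
  rw [Matrix.IsHermitian, Matrix.conjTranspose_eq_transpose_of_trivial]
  exact h

lemma gap_isHermitian {z : Pair p} (h : z.1.IsSymm) : (gap z).IsHermitian :=
  (Matrix.isHermitian_one.smul (IsSelfAdjoint.all _)).sub (isHermitian_of_isSymm h)

/-- Inside `directions E` all matrices are symmetric, so positive definiteness is an open condition.
-/
lemma isOpen_feasibleSub : IsOpen (feasibleSub E) := by
  rw [isOpen_iff_mem_nhds]
  rintro v ⟨h1, h2⟩
  have c1 : Continuous fun v : directions E => gap (v : Pair p) :=
    (contDiff_gap (k := 0)).continuous.comp continuous_subtype_val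
  have c2 : Continuous fun v : directions E => (v : Pair p).1 :=
    continuous_fst.comp continuous_subtype_val
  filter_upwards [c1.continuousAt.eventually h1.eventually_posDef,
    c2.continuousAt.eventually h2.eventually_posDef] with u hu1 hu2
  exact ⟨hu1 (gap_isHermitian u.2.1), hu2 (isHermitian_of_isSymm u.2.1)⟩

lemma convex_feasibleSub : Convex ℝ (feasibleSub E) := by
  have key : ∀ {A B : Matrix (Fin p) (Fin p) ℝ}, A.PosDef → B.PosDef → ∀ {a b : ℝ}, 0 ≤ a → 0 ≤ b →
      a + b = 1 → (a • A + b • B).PosDef := by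
    intro A B hA hB a b ha hb hab
    rcases ha.eq_or_lt with rfl | ha
    · obtain rfl : b = 1 := by linarith
      simpa using hB
    · exact (hA.smul ha).add_posSemidef (hB.posSemidef.smul hb)
  rintro u ⟨hu1, hu2⟩ v ⟨hv1, hv2⟩ a b ha hb hab
  refine ⟨?_, key hu2 hv2 ha hb hab⟩
  have : gap ((a • u + b • v : directions E) : Pair p) = a • gap (u : Pair p) + b • gap (v : Pair p) := by
    ext i j
    change (a * u.1.2 + b * v.1.2) * (1 : Matrix (Fin p) (Fin p) ℝ) i j
        - (a * u.1.1 i j + b * v.1.1 i j) =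
      a * (u.1.2 * (1 : Matrix (Fin p) (Fin p) ℝ) i j - u.1.1 i j) +
        b * (v.1.2 * (1 : Matrix (Fin p) (Fin p) ℝ) i j - v.1.1 i j)
    ring
  rw [this]
  exact key hu1 hv1 ha hb hab

/-- The second derivative is determined by derivatives of the first one along lines. -/
lemma fderiv_fderiv_eq_of_hasDerivAt_line {V : Type*} [NormedAddCommGroup V] [NormedSpace ℝ V]
    {F : V → ℝ} {U : Set V} (hU : IsOpen U) {v : V} (hv : v ∈ U) {u w : V}
    (hd : DifferentiableAt ℝ (fderiv ℝ F) v) {Φ : V → ℝ} (hΦ : ∀ y ∈ U, fderiv ℝ F y w = Φ y)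
    {a : ℝ} (ha : HasDerivAt (fun t : ℝ => Φ (v + t • u)) a 0) :
    fderiv ℝ (fderiv ℝ F) v u w = a := by
  have hline : HasDerivAt (fun t : ℝ => v + t • u) u 0 :=
    (((hasDerivAt_id (0 : ℝ)).smul_const u).const_add v).congr_deriv (one_smul ℝ u)
  have h1 := (hd.hasFDerivAt.comp_hasDerivAt_of_eq (0 : ℝ) hline (by simp)).clm_apply
    (hasDerivAt_const (0 : ℝ) w)
  simp only [map_zero, add_zero] at h1
  refine h1.unique (ha.congr_of_eventuallyEq ?_)
  have hev : ∀ᶠ t : ℝ in 𝓝 0, v + t • u ∈ U :=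
    hline.continuousAt.eventually (hU.mem_nhds (by simpa using hv))
  filter_upwards [hev] with t ht
  exact hΦ _ ht

lemma contDiffAt_objective_coe {S : Matrix (Fin p) (Fin p) ℝ} (hS : S.IsSymm) (ρ : ℝ)
    {v : directions E} (hv : v ∈ feasibleSub E) {k : WithTop ℕ∞} :
    ContDiffAt ℝ k (fun v : directions E => objective S ρ v) v :=
  (contDiffAt_objective hS ρ hv.2.det_pos hv.1.det_pos.ne').comp v
    (directions E).subtypeL.contDiff.contDiffAt

lemma fderiv_objective {S : Matrix (Fin p) (Fin p) ℝ} (hS : S.IsSymm) (ρ : ℝ) {v : directions E}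
    (hv : v ∈ feasibleSub E) (w : directions E) :
    fderiv ℝ (fun v : directions E => objective S ρ v) v w = gradForm S ρ v w := by
  have hd : DifferentiableAt ℝ (fun v : directions E => objective S ρ v) v :=
    (contDiffAt_objective_coe hS ρ hv (k := 1)).differentiableAt (by norm_num)
  have hline : HasDerivAt (fun t : ℝ => v + t • w) w 0 :=
    (((hasDerivAt_id (0 : ℝ)).smul_const w).const_add v).congr_deriv (one_smul ℝ w)
  have h1 := hd.hasFDerivAt.comp_hasDerivAt_of_eq (0 : ℝ) hline (by simp)
  exact h1.unique (hasDerivAt_objective_line hS ρ hv.2.det_pos hv.1.det_pos.ne' (w : Pair p))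

lemma fderiv_fderiv_objective {S : Matrix (Fin p) (Fin p) ℝ} (hS : S.IsSymm) (ρ : ℝ)
    {v : directions E} (hv : v ∈ feasibleSub E) (u w : directions E) :
    fderiv ℝ (fderiv ℝ (fun v : directions E => objective S ρ v)) v u w = hessForm S v u w :=
  fderiv_fderiv_eq_of_hasDerivAt_line isOpen_feasibleSub hv
    (((contDiffAt_objective_coe hS ρ hv (k := 2)).fderiv_right (m := 1)
      (by norm_num)).differentiableAt (by norm_num))
    (Φ := fun y => gradForm S ρ y w)
    (fun _ hy => fderiv_objective hS ρ hy w)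
    (hasDerivAt_gradForm_line S ρ hv.2.det_pos hv.1.det_pos.ne' (u : Pair p) (w : Pair p))

end WassersteinShrinkage

end

/-! ### Positive definite second derivative and compact sublevel sets. -/

noncomputable section

namespace WassersteinShrinkage

open scoped Matrix.Norms.Frobenius

variable {p : ℕ} {E : Set (Fin p × Fin p)}

lemma isSymm_of_isHermitian {A : Matrix (Fin p) (Fin p) ℝ} (h : A.IsHermitian) : A.IsSymm := by
  rwa [Matrix.IsHermitian, Matrix.conjTranspose_eq_transpose_of_trivial] at h

lemma gap_isSymm {z : Pair p} (h : z.1.IsSymm) : (gap z).IsSymm :=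
  isSymm_of_isHermitian (gap_isHermitian h)

lemma smul_inv_gap {z : Pair p} (h : (gap z).det ≠ 0) :
    z.2 • (gap z)⁻¹ = 1 + z.1 * (gap z)⁻¹ := by
  have := Matrix.mul_nonsing_inv _ h.isUnit
  nth_rewrite 1 [gap] at this
  rw [Matrix.sub_mul, Matrix.smul_mul, Matrix.one_mul, sub_eq_iff_eq_add] at this
  exact this

lemma smul_inv_gap' {z : Pair p} (h : (gap z).det ≠ 0) :
    z.2 • (gap z)⁻¹ = 1 + (gap z)⁻¹ * z.1 := by
  have := Matrix.nonsing_inv_mul _ h.isUnit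
  nth_rewrite 2 [gap] at this
  rw [Matrix.mul_sub, Matrix.mul_smul, Matrix.mul_one, sub_eq_iff_eq_add] at this
  exact this

/-- Completing the square: when `z.1` and `u.1` are symmetric, the second term is `2 Tr(Yᵀ R Y S)`
with `Y = d I - γ (gap u) R` and `d = u.2`, which exhibits joint convexity in `(X, γ)`. -/
lemma hessForm_self (S : Matrix (Fin p) (Fin p) ℝ) (z u : Pair p) :
    hessForm S z u u = (z.1⁻¹ * (u.1 * z.1⁻¹ * u.1)).trace +
      2 * (((u.2 • 1 - z.2 • ((gap z)⁻¹ * gap u)) * (gap z)⁻¹ *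
        (u.2 • 1 - z.2 • (gap u * (gap z)⁻¹))) * S).trace := by
  simp only [hessForm, Matrix.neg_mul, Matrix.trace_neg, Matrix.trace_add, Matrix.add_mul,
    Matrix.mul_assoc, Matrix.sub_mul, Matrix.mul_sub, Matrix.smul_mul, Matrix.mul_smul,
    Matrix.one_mul, Matrix.mul_one, Matrix.trace_sub, Matrix.trace_smul, smul_eq_mul]
  ring

/-- If `A - tI` is positive semidefinite, then `Tr(A DAD) ≥ t Tr(DAD) = t Tr(A D²) ≥ t² Tr(D²)`. -/
lemma trace_inv_mul_conj_pos {A D : Matrix (Fin p) (Fin p) ℝ} (hA : A.PosDef) (hD : D.IsSymm)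
    (hD0 : D ≠ 0) : 0 < (A * (D * A * D)).trace := by
  obtain ⟨t, ht, h⟩ := hA.exists_mul_trace_le
  have e : Dᴴ = D := by rw [Matrix.conjTranspose_eq_transpose_of_trivial, hD.eq]
  have h1 := h (D * A * D) (by simpa only [e] using hA.posSemidef.conjTranspose_mul_mul_same D)
  have h2 := h (D * D) (by simpa only [e] using Matrix.posSemidef_conjTranspose_mul_self D)
  have h3 : (A * (D * D)).trace = (D * A * D).trace := by
    rw [← Matrix.mul_assoc, Matrix.trace_mul_comm, Matrix.mul_assoc]
  have h4 : 0 < (D * D).trace := by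
    refine lt_of_le_of_ne ?_ (Ne.symm fun h0 => hD0 ?_)
    · simpa only [e] using (Matrix.posSemidef_conjTranspose_mul_self D).trace_nonneg
    · exact Matrix.trace_conjTranspose_mul_self_eq_zero_iff.1 (by rwa [e])
  have h5 : 0 < (D * A * D).trace := h3 ▸ (mul_pos ht h4).trans_le h2
  exact (mul_pos ht h5).trans_le h1

lemma hessForm_pos (hp : 0 < p) {S : Matrix (Fin p) (Fin p) ℝ} (hS : S.PosDef) {z : Pair p}
    (h1 : (gap z).PosDef) (h2 : z.1.PosDef) {u : Pair p} (hu : u.1.IsSymm) (hu0 : u ≠ 0) :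
    0 < hessForm S z u u := by
  have : Nonempty (Fin p) := ⟨⟨0, hp⟩⟩
  obtain ⟨s, hs, hsS⟩ := hS.exists_mul_trace_le
  rw [hessForm_self]
  set Y := u.2 • (1 : Matrix (Fin p) (Fin p) ℝ) - z.2 • (gap u * (gap z)⁻¹) with hY
  have hYt : u.2 • (1 : Matrix (Fin p) (Fin p) ℝ) - z.2 • ((gap z)⁻¹ * gap u) = star Y := by
    rw [hY, Matrix.star_eq_conjTranspose, Matrix.conjTranspose_sub, Matrix.conjTranspose_smul,
      Matrix.conjTranspose_smul, Matrix.conjTranspose_mul, (gap_isHermitian hu).eq,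
      h1.inv.isHermitian.eq, Matrix.conjTranspose_one]
    simp
  rw [hYt, Matrix.trace_mul_comm _ S]
  have hpsd : (star Y * (gap z)⁻¹ * Y).PosSemidef :=
    h1.inv.posSemidef.conjTranspose_mul_mul_same Y
  have hle := hsS _ hpsd
  -- The `log det` term controls every nonzero matrix component. If that component vanishes, `Y = -d
  -- X R` is invertible and the other term is positive.
  by_cases hD : u.1 = 0
  · have hd : u.2 ≠ 0 := fun h => hu0 (Prod.ext hD h)
    have hYe : Y = (-u.2) • (z.1 * (gap z)⁻¹) := by
      have hg : gap u = u.2 • 1 := by rw [gap, hD, sub_zero]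
      rw [hY, hg, Matrix.smul_mul, Matrix.one_mul, smul_comm, smul_inv_gap h1.det_pos.ne',
        smul_add, neg_smul]
      abel
    have hunit : IsUnit Y := by
      rw [hYe, Matrix.isUnit_iff_isUnit_det, Matrix.det_smul, Matrix.det_mul]
      exact (mul_ne_zero (pow_ne_zero _ (neg_ne_zero.2 hd))
        (mul_ne_zero h2.det_pos.ne' h1.inv.det_pos.ne')).isUnit
    have hpd := (Matrix.IsUnit.posDef_star_left_conjugate_iff hunit).2 h1.inv
    have := mul_pos hs hpd.trace_pos
    rw [hD, Matrix.mul_zero, Matrix.mul_zero, Matrix.trace_zero]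
    linarith
  · have := trace_inv_mul_conj_pos h2.inv hu hD
    have := mul_nonneg hs.le hpsd.trace_nonneg
    linarith

/-- The term `-γ Tr S`, of unfavourable sign, cancels against `γ²R = γI + X + XRX`, leaving `γ` with
the positive coefficient `ρ²`. -/
lemma objective_eq_barrier {S : Matrix (Fin p) (Fin p) ℝ} (hS : S.IsSymm) (ρ : ℝ) {z : Pair p}
    (h : (gap z).det ≠ 0) :
    objective S ρ z = -Real.log z.1.det + z.2 * ρ ^ 2 + (S * z.1).trace
      + (S * (z.1 * (gap z)⁻¹ * z.1)).trace := by
  have e : z.2 ^ 2 • (gap z)⁻¹ = z.2 • 1 + z.1 + z.1 * (gap z)⁻¹ * z.1 := by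
    rw [pow_two, mul_smul, smul_inv_gap h, smul_add, ← Matrix.mul_smul, smul_inv_gap' h,
      Matrix.mul_add, Matrix.mul_one, Matrix.mul_assoc, add_assoc]
  have e2 : z.2 ^ 2 * ((gap z)⁻¹ * S).trace = z.2 * S.trace + (S * z.1).trace
      + (S * (z.1 * (gap z)⁻¹ * z.1)).trace := by
    rw [Matrix.trace_mul_comm, ← smul_eq_mul, ← Matrix.trace_smul, ← Matrix.mul_smul, e,
      Matrix.mul_add, Matrix.mul_add, Matrix.trace_add, Matrix.trace_add, Matrix.mul_smul,
      Matrix.mul_one, Matrix.trace_smul, smul_eq_mul]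
  rw [objective_eq hS, e2]
  ring

lemma trace_le_of_gap {z : Pair p} (h : (gap z).PosSemidef) : z.1.trace ≤ p * z.2 := by
  have := h.trace_nonneg
  rw [gap, Matrix.trace_sub, Matrix.trace_smul, Matrix.trace_one, Fintype.card_fin,
    smul_eq_mul] at this
  linarith

/-- A priori bounds on the sublevel sets of the objective. -/
lemma exists_sublevel_bounds (hp : 0 < p) {S : Matrix (Fin p) (Fin p) ℝ} (hS : S.PosDef) {ρ : ℝ}
    (hρ : 0 < ρ) (c : ℝ) :
    ∃ s b C : ℝ, 0 < s ∧ ∀ z : Pair p, (gap z).PosDef → z.1.PosDef → objective S ρ z ≤ c →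
      z.2 ≤ b ∧ Real.exp (-c) ≤ z.1.det ∧ (z.2 ^ 2 * s) ^ p ≤ C ^ p * (gap z).det := by
  have : Nonempty (Fin p) := ⟨⟨0, hp⟩⟩
  have hp' : (0 : ℝ) < p := Nat.cast_pos.2 hp
  obtain ⟨s, hs, hsS⟩ := hS.exists_mul_trace_le
  have hSsymm := isSymm_of_isHermitian hS.isHermitian
  -- From `det X ≤ (Tr X)^p` and `log x ≤ x - 1` at `x = (s / p) Tr X` one gets `log det X ≤ s Tr X
  -- + k`; the linear part is absorbed by `Tr(SX) ≥ s Tr X`.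
  set k : ℝ := -(p + p * Real.log (s / p)) with hk
  set b := (c + k) / ρ ^ 2 with hb
  refine ⟨s, b, 2 * b * S.trace + c + k, hs, fun z h1 h2 hc => ?_⟩
  have hdet := h2.det_pos
  have htr := h2.trace_pos
  have hγ : 0 < z.2 := by
    have := trace_le_of_gap h1.posSemidef
    exact pos_of_mul_pos_right (htr.trans_le this) hp'.le
  have hQ : (z.1 * (gap z)⁻¹ * z.1).PosSemidef := by
    have := h1.inv.posSemidef.conjTranspose_mul_mul_same z.1
    rwa [h2.isHermitian.eq] at this
  have hQ0 := hS.posSemidef.trace_mul_nonneg hQ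
  have hSX0 := hS.posSemidef.trace_mul_nonneg h2.posSemidef
  have hSX := hsS _ h2.posSemidef
  have hlog : Real.log z.1.det ≤ s * z.1.trace + k := by
    have e1 : Real.log z.1.det ≤ p * Real.log z.1.trace := by
      rw [← Real.log_pow]
      refine Real.log_le_log hdet ?_
      simpa using h2.posSemidef.det_le_trace_pow
    have e2 := Real.log_le_sub_one_of_pos (show 0 < s / p * z.1.trace by positivity)
    rw [Real.log_mul (by positivity) htr.ne'] at e2
    have e3 := mul_le_mul_of_nonneg_left e2 hp'.le
    have e4 : p * (s / p * z.1.trace - 1) = s * z.1.trace - p := by field_simp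
    rw [e4] at e3
    linarith
  have hobj := objective_eq_barrier hSsymm ρ h1.det_pos.ne'
  have hρ2 : 0 < ρ ^ 2 := by positivity
  have hγρ := mul_pos hγ hρ2
  have hγb : z.2 ≤ b := by
    rw [hb, le_div_iff₀ hρ2]
    linarith
  refine ⟨hγb, ?_, ?_⟩
  · rw [← Real.le_log_iff_exp_le hdet]
    linarith
  · have hM := hS.posSemidef.trace_mul_nonneg h1.posSemidef
    rw [gap, Matrix.mul_sub, Matrix.trace_sub, Matrix.mul_smul, Matrix.mul_one, Matrix.trace_smul,
      smul_eq_mul] at hM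
    have hStr := hS.posSemidef.trace_nonneg
    have hbS : z.2 * S.trace ≤ b * S.trace := mul_le_mul_of_nonneg_right hγb hStr
    have e := objective_eq hSsymm ρ z
    have hR := hsS _ h1.inv.posSemidef
    rw [Matrix.trace_mul_comm] at hR
    have hR2 := mul_le_mul_of_nonneg_left hR (sq_nonneg z.2)
    -- Uses `s Tr X ≤ Tr(SX) ≤ γ Tr S ≤ b Tr S`; the second `b * S.trace` comes from the term `-γ Tr
    -- S` of the objective.
    have hC : z.2 ^ 2 * s * ((gap z)⁻¹).trace ≤ 2 * b * S.trace + c + k := by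
      linarith
    have hdR := h1.inv.posSemidef.det_le_trace_pow
    rw [Fintype.card_fin, Matrix.det_nonsing_inv, Ring.inverse_eq_inv'] at hdR
    have hgd := h1.det_pos
    have h3 : (z.2 ^ 2 * s) ^ p * ((gap z).det)⁻¹ ≤ (2 * b * S.trace + c + k) ^ p := by
      have htR := h1.inv.posSemidef.trace_nonneg
      calc _ ≤ (z.2 ^ 2 * s) ^ p * ((gap z)⁻¹).trace ^ p := by gcongr
        _ = (z.2 ^ 2 * s * ((gap z)⁻¹).trace) ^ p := (mul_pow _ _ _).symm
        _ ≤ _ := by gcongr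
    rwa [← div_eq_mul_inv, div_le_iff₀ hgd] at h3

lemma frobenius_norm_sq (A : Matrix (Fin p) (Fin p) ℝ) : ‖A‖ ^ 2 = (Aᵀ * A).trace := by
  have h0 : (0 : ℝ) ≤ ∑ i, ∑ j, ‖A i j‖ ^ (2 : ℝ) := by positivity
  rw [Matrix.frobenius_norm_def, ← Real.sqrt_eq_rpow, Real.sq_sqrt h0, Finset.sum_comm]
  simp [Matrix.trace, Matrix.mul_apply, pow_two]

lemma isCompact_sublevel (hp : 0 < p) {S : Matrix (Fin p) (Fin p) ℝ} (hS : S.PosDef) {ρ : ℝ}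
    (hρ : 0 < ρ) (c : ℝ) :
    IsCompact {v : directions E | v ∈ feasibleSub E ∧ objective S ρ v ≤ c} := by
  have : Nonempty (Fin p) := ⟨⟨0, hp⟩⟩
  have : ProperSpace (directions E) := FiniteDimensional.proper_real _
  have hp' : (0 : ℝ) < p := Nat.cast_pos.2 hp
  have hSsymm := isSymm_of_isHermitian hS.isHermitian
  obtain ⟨s, b, C, hs, hbd⟩ := exists_sublevel_bounds hp hS hρ c
  -- The bounds are closed conditions that exclude singular matrices, so `K` is closed yet contained
  -- in the feasible set, and the objective is continuous on it.
  set K : Set (directions E) := {v | (gap (v : Pair p)).PosSemidef ∧ (v : Pair p).1.PosSemidef ∧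
    (v : Pair p).2 ≤ b ∧ Real.exp (-c) ≤ (v : Pair p).1.det ∧
    ((v : Pair p).2 ^ 2 * s) ^ p ≤ C ^ p * (gap (v : Pair p)).det} with hK
  have c1 : Continuous fun v : directions E => gap (v : Pair p) :=
    (contDiff_gap (k := 0)).continuous.comp continuous_subtype_val
  have c2 : Continuous fun v : directions E => (v : Pair p).1 :=
    continuous_fst.comp continuous_subtype_val
  have c3 : Continuous fun v : directions E => (v : Pair p).2 :=
    continuous_snd.comp continuous_subtype_val
  have hKclosed : IsClosed K :=
    (Matrix.isClosed_posSemidef.preimage c1).inter <|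
      (Matrix.isClosed_posSemidef.preimage c2).inter <|
      (isClosed_le c3 continuous_const).inter <|
      (isClosed_le continuous_const c2.matrix_det).inter
      (isClosed_le (((c3.pow 2).mul continuous_const).pow p)
        (continuous_const.mul c1.matrix_det))
  have hKsub : K ⊆ feasibleSub E := by
    rintro v ⟨h1, h2, -, h4, h5⟩
    have hX : (v : Pair p).1.PosDef :=
      h2.posDef_iff_det_ne_zero.2 ((Real.exp_pos _).trans_le h4).ne'
    have hγ : 0 < (v : Pair p).2 :=
      pos_of_mul_pos_right (hX.trace_pos.trans_le (trace_le_of_gap h1)) hp'.le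
    refine ⟨h1.posDef_iff_det_ne_zero.2 fun h0 => ?_, hX⟩
    rw [h0, mul_zero] at h5
    have : 0 < ((v : Pair p).2 ^ 2 * s) ^ p := by positivity
    linarith
  have hcont : ContinuousOn (fun v : directions E => objective S ρ v) K := fun v hv =>
    (contDiffAt_objective_coe hSsymm ρ (hKsub hv) (k := 0)).continuousAt.continuousWithinAt
  have heq : {v : directions E | v ∈ feasibleSub E ∧ objective S ρ v ≤ c} =
      K ∩ (fun v : directions E => objective S ρ v) ⁻¹' Set.Iic c := by
    ext v
    refine ⟨fun h => ⟨?_, h.2⟩, fun h => ⟨hKsub h.1, h.2⟩⟩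
    exact ⟨h.1.1.posSemidef, h.1.2.posSemidef, hbd _ h.1.1 h.1.2 h.2⟩
  rw [heq]
  refine Metric.isCompact_of_isClosed_isBounded
    (hcont.preimage_isClosed_of_isClosed hKclosed isClosed_Iic) ?_
  refine (isBounded_iff_forall_norm_le.2 ⟨b * (p + 1), ?_⟩ : Bornology.IsBounded K).subset
    Set.inter_subset_left
  rintro v ⟨h1, h2, h3, -, -⟩
  have ht := trace_le_of_gap h1
  have hγ : 0 ≤ (v : Pair p).2 :=
    nonneg_of_mul_nonneg_right (h2.trace_nonneg.trans ht) hp'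
  have hb0 : 0 ≤ b := hγ.trans h3
  -- `Tr(X(γI - X)) ≥ 0` gives `‖X‖² ≤ γ Tr X`, and `Tr X ≤ pγ`.
  have hX2 : ‖(v : Pair p).1‖ ^ 2 ≤ b ^ 2 * p := by
    have h6 := h2.trace_mul_nonneg h1
    rw [gap, Matrix.mul_sub, Matrix.trace_sub, Matrix.mul_smul, Matrix.mul_one, Matrix.trace_smul,
      smul_eq_mul] at h6
    rw [frobenius_norm_sq, v.2.1.eq]
    calc _ ≤ (v : Pair p).2 * (v : Pair p).1.trace := by linarith
      _ ≤ b * (p * b) := by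
        gcongr
        · exact h2.trace_nonneg
        · exact ht.trans (by gcongr)
      _ = _ := by ring
  have hp1 : (1 : ℝ) ≤ p := Nat.one_le_cast.2 hp
  have hX : ‖(v : Pair p).1‖ ≤ b * (p + 1) := by
    refine le_of_sq_le_sq (hX2.trans ?_) (by positivity)
    nlinarith [sq_nonneg b, mul_nonneg (sq_nonneg b) hp'.le, mul_nonneg (sq_nonneg b) (sq_nonneg (p : ℝ))]
  have hY : ‖(v : Pair p).2‖ ≤ b * (p + 1) := by
    rw [Real.norm_of_nonneg hγ]
    nlinarith
  exact max_le hX hY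

/-- The objective, restricted to the linear span of the feasible set, is a convex barrier. -/
theorem isConvexBarrier_objective (hp : 0 < p) {S : Matrix (Fin p) (Fin p) ℝ} (hS : S.PosDef) {ρ : ℝ}
    (hρ : 0 < ρ) :
    DampedNewton.IsConvexBarrier (fun v : directions E => objective S ρ v) (feasibleSub E) := by
  have hSsymm := isSymm_of_isHermitian hS.isHermitian
  refine ⟨isOpen_feasibleSub, convex_feasibleSub, fun v hv => contDiffAt_objective_coe hSsymm ρ hv,
    fun v hv u hu => ?_, fun c => isCompact_sublevel hp hS hρ c⟩
  exact (hessForm_pos hp hS hv.1 hv.2 u.2.1 (by simpa using hu)).trans_eq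
    (fderiv_fderiv_objective hSsymm ρ hv u u).symm

end WassersteinShrinkage

end

/-! ### The algorithm as a damped Newton method on the span. -/

noncomputable section

namespace WassersteinShrinkage

variable {p : ℕ} {E : Set (Fin p × Fin p)}

lemma inv_matG {z : Pair p} (hz : z.2 ≠ 0) (h : (gap z).det ≠ 0) :
    (matG z)⁻¹ = z.2 • (gap z)⁻¹ := by
  have e : matG z = z.2⁻¹ • gap z := by
    rw [matG, gap, smul_sub, smul_smul, inv_mul_cancel₀ hz, one_smul]
  refine Matrix.inv_eq_right_inv ?_
  rw [e, Matrix.smul_mul, Matrix.mul_smul, smul_smul, inv_mul_cancel₀ hz, one_smul,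
    Matrix.mul_nonsing_inv _ h.isUnit]

lemma gradVec_dotProduct {S : Matrix (Fin p) (Fin p) ℝ} (hS : S.IsSymm) (ρ : ℝ) {z w : Pair p}
    (hz : z.2 ≠ 0) (h : (gap z).det ≠ 0) (hzs : z.1.IsSymm) :
    gradVec S ρ z ⬝ᵥ pairVec w = gradForm S ρ z w := by
  have hR : ((gap z)⁻¹)ᵀ = (gap z)⁻¹ := by
    rw [Matrix.transpose_nonsing_inv, (gap_isSymm hzs).eq]
  have hX : (z.1⁻¹)ᵀ = z.1⁻¹ := by rw [Matrix.transpose_nonsing_inv, hzs.eq]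
  have hXR : z.1 * (gap z)⁻¹ = z.2 • (gap z)⁻¹ - 1 := by rw [smul_inv_gap h]; abel
  have hRX : (gap z)⁻¹ * z.1 = z.2 • (gap z)⁻¹ - 1 := by rw [smul_inv_gap' h]; abel
  rw [gradVec, pairVec, sumElim_dotProduct_sumElim, Matrix.vec_dotProduct_vec, inv_matG hz h,
    gradForm]
  have hgw : gap w = w.2 • 1 - w.1 := rfl
  rw [hgw]
  -- Once `X` is eliminated through `RX = γR - 1`, both sides are combinations of traces of words in
  -- noncommuting letters, matched by cyclicity.
  generalize (gap z)⁻¹ = R at *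
  generalize z.1⁻¹ = Y at *
  have t1 := Matrix.trace_mul_comm R S
  have t2 := Matrix.trace_mul_comm R (S * R)
  have t3 := Matrix.trace_mul_comm R (R * S)
  have t4 := Matrix.trace_mul_comm (R * w.1) (R * S)
  simp only [Matrix.mul_assoc] at t2 t3 t4
  have e1 : z.2⁻¹ * z.2 = 1 := inv_mul_cancel₀ hz
  simp only [Matrix.transpose_sub, Matrix.transpose_mul, Matrix.transpose_smul, hR, hS.eq, hX,
    Matrix.smul_mul, Matrix.mul_smul, smul_smul, Matrix.sub_mul, Matrix.mul_sub, hRX,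
    Matrix.mul_one, Matrix.trace_sub, Matrix.trace_smul, Matrix.mul_assoc,
    smul_eq_mul, dotProduct, Finset.univ_unique, Finset.sum_singleton, Matrix.neg_mul,
    Matrix.trace_neg, smul_sub, t2, t3, t4]
  field_simp
  ring

lemma hessMat_dotProduct {S : Matrix (Fin p) (Fin p) ℝ} (hS : S.IsSymm) {z u w : Pair p}
    (hz : z.2 ≠ 0) (h : (gap z).det ≠ 0) (hzs : z.1.IsSymm) (hu : u.1.IsSymm) (hw : w.1.IsSymm) :
    (hessMat S z *ᵥ pairVec u) ⬝ᵥ pairVec w = hessForm S z u w := by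
  have hR : ((gap z)⁻¹)ᵀ = (gap z)⁻¹ := by
    rw [Matrix.transpose_nonsing_inv, (gap_isSymm hzs).eq]
  have hX : (z.1⁻¹)ᵀ = z.1⁻¹ := by rw [Matrix.transpose_nonsing_inv, hzs.eq]
  have hXR : z.1 * (gap z)⁻¹ = z.2 • (gap z)⁻¹ - 1 := by rw [smul_inv_gap h]; abel
  have hRX : (gap z)⁻¹ * z.1 = z.2 • (gap z)⁻¹ - 1 := by rw [smul_inv_gap' h]; abel
  have hgu : gap u = u.2 • 1 - u.1 := rfl
  have hgw : gap w = w.2 • 1 - w.1 := rfl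
  have hcol : Matrix.replicateCol Unit (hessMixed S z) *ᵥ (fun _ : Unit => u.2)
      = u.2 • hessMixed S z := by
    ext i
    simp [Matrix.mulVec, dotProduct, mul_comm]
  have hrow : Matrix.replicateRow Unit (hessMixed S z) *ᵥ Matrix.vec u.1
      = fun _ => hessMixed S z ⬝ᵥ Matrix.vec u.1 := by
    ext i
    simp [Matrix.mulVec, dotProduct]
  rw [hessMat, pairVec, pairVec, Matrix.fromBlocks_mulVec]
  simp only [Sum.elim_comp_inl, Sum.elim_comp_inr]
  rw [sumElim_dotProduct_sumElim, hcol, hrow, hessMixed, Matrix.add_mulVec,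
    Matrix.smul_mulVec, Matrix.kronecker_mulVec_vec, Matrix.kronecker_mulVec_vec, inv_matG hz h,
    hessForm, hgu, hgw]
  generalize (gap z)⁻¹ = R at *
  generalize z.1⁻¹ = Y at *
  have q1 := Matrix.trace_mul_comm R S
  have q2 := Matrix.trace_mul_comm R (S * R)
  have q3 := Matrix.trace_mul_comm R (R * S)
  have q4 := Matrix.trace_mul_comm (R * R) (R * S)
  have q5 := Matrix.trace_mul_comm (R * R) (S * R)
  have q6 := Matrix.trace_mul_comm R (S * (R * R))
  have r1 := fun D => Matrix.trace_mul_comm (R * D) (R * R * S)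
  have r2 := fun D => Matrix.trace_mul_comm (R * R * D) (R * S)
  have r3 := fun D => Matrix.trace_mul_comm (R * D) (R * S)
  have r4 := Matrix.trace_mul_comm (R * u.1 * R * w.1) (R * S)
  -- Transposition reverses the word. This needs symmetric `u.1` and `w.1`: it is what lets the
  -- one-sided Kronecker term of `H` stand for the symmetric second derivative.
  have r5 : (R * w.1 * R * u.1 * R * S).trace = (R * S * R * u.1 * R * w.1).trace := by
    rw [← Matrix.trace_transpose]
    simp only [Matrix.transpose_mul, hR, hS.eq, hu.eq, hw.eq]
    have := Matrix.trace_mul_comm (S * R * u.1 * R * w.1) R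
    simp only [Matrix.mul_assoc] at this ⊢
    exact this
  simp only [Matrix.mul_assoc] at q1 q2 q3 q4 q5 q6 r1 r2 r3 r4 r5
  simp only [Matrix.transpose_sub, Matrix.transpose_add, Matrix.transpose_mul,
    Matrix.transpose_smul, hR, hS.eq, hX, hu.eq, Matrix.vec_dotProduct_vec, add_dotProduct,
    smul_dotProduct, Matrix.smul_mul, Matrix.mul_smul, smul_smul, Matrix.sub_mul, Matrix.mul_sub,
    hRX, hXR, Matrix.mul_add, Matrix.add_mul, Matrix.trace_add, Matrix.mul_one,
    Matrix.one_mul, Matrix.trace_sub, Matrix.trace_smul, Matrix.mul_assoc, smul_eq_mul,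
    Matrix.neg_mul, Matrix.trace_neg, smul_sub]
  simp only [dotProduct, Matrix.mulVec, Matrix.of_apply, Finset.univ_unique, Finset.sum_singleton,
    q1, q2, q3, q4, q5, q6, r1, r2, r3, r4, r5]
  field_simp
  ring

/-- The projection acts trivially in products with vectors from the subspace. -/
lemma proj_dotProduct (v : Idx p → ℝ) (w : directions E) :
    proj E v ⬝ᵥ pairVec (w : Pair p) = v ⬝ᵥ pairVec (w : Pair p) := by
  have key : ∀ i j, proj E v (Sum.inl (j, i)) * w.1.1 i j =
      1 / 2 * (v (Sum.inl (j, i)) * w.1.1 i j) + 1 / 2 * (v (Sum.inl (i, j)) * w.1.1 j i) := by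
    intro i j
    rw [w.2.1.apply i j]
    by_cases h : (i, j) ∈ E
    · simp [proj, w.2.2 i j h]
    · simp only [proj, h, if_false]
      ring
  have hsum : ∑ j, ∑ i, proj E v (Sum.inl (j, i)) * w.1.1 i j =
      ∑ j, ∑ i, v (Sum.inl (j, i)) * w.1.1 i j := by
    simp only [key, Finset.sum_add_distrib, ← Finset.mul_sum]
    rw [Finset.sum_comm (f := fun j i => v (Sum.inl (i, j)) * w.1.1 j i)]
    ring
  simp only [dotProduct, Fintype.sum_sum_type, Fintype.sum_prod_type, pairVec, Sum.elim_inl,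
    Sum.elim_inr, Matrix.vec]
  rw [hsum]
  rfl

lemma exists_pairVec_eq_proj (hE : ∀ i j, (i, j) ∈ E → (j, i) ∈ E) (v : Idx p → ℝ) :
    ∃ w : directions E, pairVec (w : Pair p) = proj E v := by
  refine ⟨⟨(Matrix.of fun i j => proj E v (Sum.inl (j, i)), proj E v (Sum.inr ())), ?_, ?_⟩, ?_⟩
  · ext i j
    have hEiff : (i, j) ∈ E ↔ (j, i) ∈ E := ⟨hE i j, hE j i⟩
    by_cases h : (j, i) ∈ E
    · simp [proj, h, hEiff.2 h]
    · simp only [Matrix.transpose_apply, Matrix.of_apply, proj, h, mt hEiff.1 h, if_false]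
      ring
  · intro i j h
    simp [proj, h]
  · ext (⟨j, i⟩ | _) <;> rfl

/-- For the converse, testing against `w = P v` gives `|P v|² = 0`. -/
lemma proj_eq_zero_iff (hE : ∀ i j, (i, j) ∈ E → (j, i) ∈ E) (v : Idx p → ℝ) :
    proj E v = 0 ↔ ∀ w : directions E, v ⬝ᵥ pairVec (w : Pair p) = 0 := by
  refine ⟨fun h w => by rw [← proj_dotProduct, h, zero_dotProduct], fun h => ?_⟩
  obtain ⟨w, hw⟩ := exists_pairVec_eq_proj hE v
  have := h w
  rw [← proj_dotProduct, hw] at this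
  exact dotProduct_self_eq_zero.1 this

open scoped Matrix.Norms.Frobenius

lemma snd_pos_of_mem (hp : 0 < p) {z : Pair p} (h1 : (gap z).PosDef) (h2 : z.1.PosDef) :
    0 < z.2 := by
  have : Nonempty (Fin p) := ⟨⟨0, hp⟩⟩
  exact pos_of_mul_pos_right (h2.trace_pos.trans_le (trace_le_of_gap h1.posSemidef))
    (Nat.cast_nonneg p)

lemma isDirection_iff (hp : 0 < p) (hE : ∀ i j, (i, j) ∈ E → (j, i) ∈ E)
    {S : Matrix (Fin p) (Fin p) ℝ} (hS : S.IsSymm) (ρ : ℝ)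
    {v : directions E} (hv : v ∈ feasibleSub E) (d : Pair p) :
    IsDirection S ρ E v d ↔ ∃ u : directions E, (u : Pair p) = d ∧
      fderiv ℝ (fderiv ℝ (fun v : directions E => objective S ρ v)) v u =
        -fderiv ℝ (fun v : directions E => objective S ρ v) v := by
  have hγ := (snd_pos_of_mem hp hv.1 hv.2).ne'
  have key : ∀ u : directions E,
      proj E (hessMat S (v : Pair p) *ᵥ pairVec (u : Pair p) + gradVec S ρ (v : Pair p)) = 0 ↔
      fderiv ℝ (fderiv ℝ (fun v : directions E => objective S ρ v)) v u =
        -fderiv ℝ (fun v : directions E => objective S ρ v) v := by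
    intro u
    rw [proj_eq_zero_iff hE, ContinuousLinearMap.ext_iff]
    refine forall_congr' fun w => ?_
    rw [add_dotProduct, hessMat_dotProduct hS hγ hv.1.det_pos.ne' v.2.1 u.2.1 w.2.1,
      gradVec_dotProduct hS ρ hγ hv.1.det_pos.ne' v.2.1, add_eq_zero_iff_eq_neg]
    have e1 := fderiv_fderiv_objective hS ρ hv u w
    have e2 := fderiv_objective hS ρ hv w
    exact Eq.congr e1.symm (congrArg Neg.neg e2.symm)
  constructor
  · rintro ⟨h1, h2, h3⟩
    exact ⟨⟨d, h1, h3⟩, rfl, (key ⟨d, h1, h3⟩).1 h2⟩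
  · rintro ⟨u, rfl, hu⟩
    exact ⟨u.2.1, (key u).2 hu, u.2.2⟩

lemma admissibleSteps_eq (hp : 0 < p) {S : Matrix (Fin p) (Fin p) ℝ} (hS : S.IsSymm) (ρ σ : ℝ)
    {v : directions E} (hv : v ∈ feasibleSub E) (u : directions E) :
    admissibleSteps S ρ σ (v : Pair p) (u : Pair p) =
      DampedNewton.armijoSteps (fun v : directions E => objective S ρ v) (feasibleSub E) σ v u := by
  have hγ := (snd_pos_of_mem hp hv.1 hv.2).ne'
  have e := (gradVec_dotProduct (w := (u : Pair p)) hS ρ hγ hv.1.det_pos.ne' v.2.1).trans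
    (fderiv_objective hS ρ hv u).symm
  rw [admissibleSteps, e]
  rfl

lemma mem_feasibleSet_iff {z : Pair p} :
    z ∈ feasibleSet E ↔ ∃ v ∈ feasibleSub E, (v : Pair p) = z := by
  constructor
  · rintro ⟨h1, h2, h3⟩
    exact ⟨⟨z, isSymm_of_isHermitian h2.isHermitian, h3.2⟩, ⟨h1, h2⟩, rfl⟩
  · rintro ⟨v, ⟨h1, h2⟩, rfl⟩
    exact ⟨h1, h2, h2, v.2.2⟩

/-- One iteration of the algorithm is one damped Newton step. -/
lemma iteration_iff (hp : 0 < p) (hE : ∀ i j, (i, j) ∈ E → (j, i) ∈ E)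
    {S : Matrix (Fin p) (Fin p) ℝ} (hS : S.IsSymm) (ρ σ : ℝ)
    {v : directions E} (hv : v ∈ feasibleSub E) (z' : Pair p) :
    (∃ (d : Pair p) (α : ℝ), IsDirection S ρ E v d ∧
      IsGreatest (admissibleSteps S ρ σ v d) α ∧ z' = v + α • d) ↔
    ∃ v' : directions E, (v' : Pair p) = z' ∧
      DampedNewton.Step (fun v : directions E => objective S ρ v) (feasibleSub E) σ v v' := by
  constructor
  · rintro ⟨d, α, hd, hα, rfl⟩
    obtain ⟨u, rfl, hu⟩ := (isDirection_iff hp hE hS ρ hv d).1 hd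
    rw [admissibleSteps_eq hp hS ρ σ hv] at hα
    exact ⟨v + α • u, rfl, u, α, hu, hα, rfl⟩
  · rintro ⟨_, rfl, u, α, hu, hα, rfl⟩
    rw [← admissibleSteps_eq hp hS ρ σ hv] at hα
    exact ⟨u, α, (isDirection_iff hp hE hS ρ hv u).2 ⟨u, rfl, hu⟩, hα, rfl⟩

lemma isRun_iff (hp : 0 < p) (hE : ∀ i j, (i, j) ∈ E → (j, i) ∈ E)
    {S : Matrix (Fin p) (Fin p) ℝ} (hS : S.IsSymm) (ρ σ : ℝ)
    {v₀ : directions E} (hv₀ : v₀ ∈ feasibleSub E) (z : ℕ → Pair p) :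
    IsRun S ρ σ E v₀ z ↔ ∃ v : ℕ → directions E, (∀ t, (v t : Pair p) = z t) ∧ v 0 = v₀ ∧
      ∀ t, DampedNewton.Step (fun v : directions E => objective S ρ v) (feasibleSub E) σ
        (v t) (v (t + 1)) := by
  constructor
  · rintro ⟨h0, hz⟩
    have hmem : ∀ t, ∃ v ∈ feasibleSub E, (v : Pair p) = z t := by
      intro t
      induction t with
      | zero => exact ⟨v₀, hv₀, h0.symm⟩
      | succ t ih =>
        obtain ⟨v, hv, hvz⟩ := ih
        have := hz t
        rw [← hvz, iteration_iff hp hE hS ρ σ hv] at this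
        obtain ⟨v', h1, h2⟩ := this
        exact ⟨v', h2.mem, h1⟩
    choose v hv hvz using hmem
    refine ⟨v, hvz, Subtype.ext ((hvz 0).trans h0), fun t => ?_⟩
    have := hz t
    rw [← hvz, iteration_iff hp hE hS ρ σ (hv t)] at this
    obtain ⟨v', h1, h2⟩ := this
    obtain rfl : v' = v (t + 1) := Subtype.ext (h1.trans (hvz (t + 1)).symm)
    exact h2
  · rintro ⟨v, hvz, rfl, hv⟩
    obtain rfl : (fun t => (v t : Pair p)) = z := funext hvz
    refine ⟨rfl, fun t => ?_⟩
    have hmem : v t ∈ feasibleSub E := by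
      cases t with
      | zero => exact hv₀
      | succ t => exact (hv t).mem
    exact (iteration_iff hp hE hS ρ σ hmem _).2 ⟨v (t + 1), rfl, hv t⟩

/-- The norm on pairs is the maximum of the Frobenius norm and `|γ|`. With `pairNorm_le` this
transfers the quadratic estimate to the Euclidean norm. -/
lemma norm_le_pairNorm (w : directions E) : ‖w‖ ≤ pairNorm (w : Pair p) := by
  have h : (0 : ℝ) ≤ ((w : Pair p).1ᵀ * (w : Pair p).1).trace := by
    rw [← frobenius_norm_sq]; positivity
  refine max_le ?_ ?_
  · refine Real.le_sqrt_of_sq_le ?_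
    rw [frobenius_norm_sq]
    exact le_add_of_nonneg_right (sq_nonneg _)
  · refine Real.le_sqrt_of_sq_le ?_
    rw [Real.norm_eq_abs, sq_abs]
    exact le_add_of_nonneg_left h

lemma pairNorm_le (w : directions E) : pairNorm (w : Pair p) ≤ 2 * ‖w‖ := by
  have h1 : ‖(w : Pair p).1‖ ≤ ‖w‖ := le_max_left _ _
  have h2 : ‖(w : Pair p).2‖ ≤ ‖w‖ := le_max_right _ _
  refine Real.sqrt_le_iff.2 ⟨by positivity, ?_⟩
  rw [← frobenius_norm_sq, ← sq_abs (w : Pair p).2, ← Real.norm_eq_abs]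
  have h3 := pow_le_pow_left₀ (norm_nonneg _) h1 2
  have h4 := pow_le_pow_left₀ (norm_nonneg _) h2 2
  nlinarith [sq_nonneg ‖w‖]

lemma nonempty_feasibleSub (hE : ∀ i, (i, i) ∉ E) : (feasibleSub E).Nonempty := by
  -- The pair `(I, 2)` is feasible: its gap is `I`, and `I` vanishes on `E` because `E` avoids the
  -- diagonal.
  refine ⟨⟨(1, 2), Matrix.isSymm_one, fun i j h => Matrix.one_apply_ne ?_⟩, ?_, Matrix.PosDef.one⟩
  · rintro rfl
    exact hE i h
  · have : gap ((1, 2) : Pair p) = 1 := by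
      rw [gap, two_smul, add_sub_cancel_right]
    change (gap ((1, 2) : Pair p)).PosDef
    rw [this]
    exact Matrix.PosDef.one

end WassersteinShrinkage

end

/-! ### Assembly of the theorem. -/

theorem proposition4p3 {p : ℕ} (hp : 0 < p)
    (S : Matrix (Fin p) (Fin p) ℝ) (hS : S.PosDef)
    (ρ : ℝ) (hρ : 0 < ρ)
    (σ : ℝ) (hσ : σ ∈ Set.Ioo (0 : ℝ) (1 / 2))
    (E : Set (Fin p × Fin p))
    (hE_symm : ∀ i j, (i, j) ∈ E → (j, i) ∈ E)
    (hE_diag : ∀ i, (i, i) ∉ E) :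
    ∃ zs : WassersteinShrinkage.Pair p,
      -- unique minimizer
      WassersteinShrinkage.IsMinimizer S ρ E zs ∧
      (∀ w, WassersteinShrinkage.IsMinimizer S ρ E w → w = zs) ∧
      -- from every feasible start the algorithm generates exactly one sequence, and it converges
      (∀ z₀ ∈ WassersteinShrinkage.feasibleSet E,
        ∃! z : ℕ → WassersteinShrinkage.Pair p, WassersteinShrinkage.IsRun S ρ σ E z₀ z) ∧
      (∀ z₀ ∈ WassersteinShrinkage.feasibleSet E, ∀ z : ℕ → WassersteinShrinkage.Pair p,
        WassersteinShrinkage.IsRun S ρ σ E z₀ z → Tendsto z atTop (𝓝 zs)) ∧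
      -- local quadratic convergence, with constants that do not depend on the start
      (∃ ε > 0, ∃ C > 0,
        ∀ z₀ ∈ WassersteinShrinkage.feasibleSet E, ∀ z : ℕ → WassersteinShrinkage.Pair p,
          WassersteinShrinkage.IsRun S ρ σ E z₀ z → ∀ t,
            WassersteinShrinkage.pairNorm (z t - zs) < ε →
              WassersteinShrinkage.pairNorm (z (t + 1) - zs)
                ≤ C * WassersteinShrinkage.pairNorm (z t - zs) ^ 2) := by
  open scoped Matrix.Norms.Frobenius in
  have hS' := WassersteinShrinkage.isSymm_of_isHermitian hS.isHermitian
  have hB := WassersteinShrinkage.isConvexBarrier_objective (E := E) hp hS hρ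
  have hσ1 : σ ∈ Set.Ioo (0 : ℝ) 1 := ⟨hσ.1, by linarith [hσ.2]⟩
  obtain ⟨vs, hvs, hgs⟩ := hB.exists_minimizer (WassersteinShrinkage.nonempty_feasibleSub hE_diag)
  refine ⟨vs, ⟨WassersteinShrinkage.mem_feasibleSet_iff.2 ⟨vs, hvs, rfl⟩, ?_⟩, ?_, ?_, ?_, ?_⟩
  · intro w hw
    obtain ⟨v, hv, rfl⟩ := WassersteinShrinkage.mem_feasibleSet_iff.1 hw
    by_cases h : v = vs
    · rw [h]
    · exact (hB.lt_of_ne hvs hv h hgs).le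
  · rintro w ⟨hw, hmin⟩
    obtain ⟨v, hv, rfl⟩ := WassersteinShrinkage.mem_feasibleSet_iff.1 hw
    by_contra h
    have h1 := hB.lt_of_ne hvs hv (fun h' => h (congrArg _ h')) hgs
    exact absurd (hmin vs (WassersteinShrinkage.mem_feasibleSet_iff.2 ⟨vs, hvs, rfl⟩)) (not_le.2 h1)
  · intro z₀ hz₀
    obtain ⟨v₀, hv₀, rfl⟩ := WassersteinShrinkage.mem_feasibleSet_iff.1 hz₀
    simp only [WassersteinShrinkage.isRun_iff hp hE_symm hS' ρ σ hv₀]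
    have hstep := fun v : WassersteinShrinkage.feasibleSub E =>
      (hB.existsUnique_step hσ1.2 v.2).exists
    choose next hnext using hstep
    -- The recursion runs in the subtype, so that feasibility, needed for the next step to exist, is
    -- carried along.
    let x : ℕ → WassersteinShrinkage.feasibleSub E := fun t =>
      Nat.rec ⟨v₀, hv₀⟩ (fun _ y => ⟨next y, (hnext y).mem⟩) t
    have hx : ∀ t, DampedNewton.Step
      (fun v : WassersteinShrinkage.directions E => WassersteinShrinkage.objective S ρ v)
      (WassersteinShrinkage.feasibleSub E) σ
      (x t).1 (x (t + 1)).1 := fun t => hnext (x t)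
    refine ⟨fun t => (x t).1, ⟨fun t => (x t).1, fun t => rfl, rfl, hx⟩, ?_⟩
    rintro z ⟨v, hvz, hv0, hv⟩
    have : ∀ t, v t = (x t).1 := by
      intro t
      induction t with
      | zero => exact hv0
      | succ t ih =>
        have h1 := hv t
        rw [ih] at h1
        exact (hB.existsUnique_step hσ1.2 (x t).2).unique h1 (hx t)
    funext t
    rw [← hvz t, this t]
  · intro z₀ hz₀ z hz
    obtain ⟨v₀, hv₀, rfl⟩ := WassersteinShrinkage.mem_feasibleSet_iff.1 hz₀
    obtain ⟨v, hvz, rfl, hv⟩ := (WassersteinShrinkage.isRun_iff hp hE_symm hS' ρ σ hv₀ z).1 hz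
    obtain rfl : (fun t => (v t : WassersteinShrinkage.Pair p)) = z := funext hvz
    exact (continuous_subtype_val.tendsto vs).comp (hB.tendsto_of_step hσ1 hvs hgs hv₀ hv)
  · obtain ⟨ε, hε, C, hC, hq⟩ := hB.exists_quadratic hσ hvs hgs
    -- The factor 2 is the cost of passing between the two norms in `pairNorm_le`.
    refine ⟨ε, hε, 2 * C, by positivity, ?_⟩
    intro z₀ hz₀ z hz t ht
    obtain ⟨v₀, hv₀, rfl⟩ := WassersteinShrinkage.mem_feasibleSet_iff.1 hz₀
    obtain ⟨v, hvz, rfl, hv⟩ := (WassersteinShrinkage.isRun_iff hp hE_symm hS' ρ σ hv₀ z).1 hz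
    rw [← hvz] at ht ⊢
    rw [← hvz]
    have h1 := WassersteinShrinkage.norm_le_pairNorm (v t - vs)
    have h2 := WassersteinShrinkage.pairNorm_le (v (t + 1) - vs)
    have h3 := hq _ _ (hv t) (h1.trans_lt ht)
    calc _ ≤ _ := h2
      _ ≤ _ := mul_le_mul_of_nonneg_left h3 zero_le_two
      _ ≤ _ := mul_le_mul_of_nonneg_left
        (mul_le_mul_of_nonneg_left (pow_le_pow_left₀ (norm_nonneg _) h1 2) hC.le) zero_le_two
      _ = _ := (mul_assoc _ _ _).symm
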